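/- Let $\mathfrak g$ be a finite-dimensional real Lie algebra and $E=\mathfrak g\oplus\mathfrak g^*$ with the pairing $\langle X+\xi,Y+\eta\rangle=\tfrac12(\eta(X)+\xi(Y))$. A generalised Riemannian metric on $\mathfrak g$ is a pair $(H,\mathcal G_g)$, where $H\in\Lambda^3\mathfrak g^*$ is closed (for the Chevalley–Eilenberg differential), $g$ is a Euclidean inner product on $\mathfrak g$, and $\mathcal G_g(X+\xi)=g^{-1}\xi+gX$; let $E_\pm$ be the $\pm1$-eigenspaces of $\mathcal G_g$. The $H$-twisted Dorfman bracket on $E$ is $[X+\xi,Y+\eta]_H=[X,Y]-\eta\circ\mathrm{ad}_X+\xi\circ\mathrm{ad}_Y+H(X,Y,\cdot)$. A generalised Levi-Civita connection is a bilinear map $D:E\times E\to E$, $(a,b)\mapsto D_ab$, with $\langle D_ab,c\rangle+\langle b,D_ac\rangle=0$, $D_a\mathcal G_g=\mathcal G_gD_a$ and $D_ab-D_ba-[a,b]_H+(Da)^*b=0$, where $Da$ is the endomorphism $e\mapsto D_ea$ and $(Da)^*$ is its adjoint with respect to $\langle\cdot,\cdot\rangle$; its divergence operator is $\delta_D\in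 E^*$, $\delta_D(e)=\operatorname{tr}(De)$. Its generalised Ricci curvatures are $\mathcal{RC}^\pm_D(b,c)=\operatorname{tr}\bigl(E_\pm\ni a\mapsto D_aD_bc-D_bD_ac-D_{[a,b]_H}c\in E_\pm\bigr)$ for $b\in E_\mp$, $c\in E_\pm$. For a divergence operator $\delta\in E^*$, $(\mathfrak g,H,\mathcal G_g,\delta)$ is called a generalised Einstein Riemannian Lie algebra if there are generalised Levi-Civita connections with $\delta_D=\delta$, and $\mathcal{RC}^+_D=0$ and $\mathcal{RC}^-_D=0$ for all of them. An isomorphism of such tuples is an isomorphism $f$ of Lie algebras that identifies the inner products and the three-forms, and such that $X+\xi\mapsto f(X)+\xi\circ f^{-1}$ identifies the divergence operators. For a basis $(e_1,\dots,e_4)$ of $\mathfrak g$, let $(e^1,\dots,e^4)$ be the dual basis and $e^{123}=e^1\wedge e^2\wedge e^3$, so that $e^{123}(e_1,e_2,e_3)=1$; vectors and covectors are also regarded as elements of $E^*\cong\mathfrak g^*\oplus\mathfrak g$ by evaluation. **Theorem.** Any four-dimensional generalised Einstein Riemannian Lie algebra $(\mathfrak g,H,\mathcal G_g,\delta)$ is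 isomorphic to one of the following: (i) $(\mathbb R^4,H=0,\mathcal G_g,\delta)$ with $\mathbb R^4$ Abelian, an arbitrary Riemannian metric $g$ and an arbitrary $\delta\in E^*$; (ii) $(\mathfrak e(2)\oplus\mathbb R,H=0,\mathcal G_g,\delta)$ such that $\mathfrak e(2)\oplus\mathbb R$ admits a $g$-orthonormal basis $(e_1,\dots,e_4)$ with the only non-zero Lie brackets of basis vectors (up to anti-symmetry) being $$[e_3,e_1]=a\,e_2,\qquad [e_3,e_2]=-a\,e_1$$ for some $a>0$, and $\delta\in\operatorname{span}\{e_3,e_4,e^3,e^4\}$; (iii) $(\mathfrak{so}(3)\oplus\mathbb R,H,\mathcal G_g,\delta)$ such that there exist $a\in\mathbb R\setminus\{0\}$, $b\in\mathbb R$, $\epsilon\in\{-1,1\}$ and a $g$-orthonormal basis $(e_1,\dots,e_4)$ with $H=a\,e^{123}$, the only possibly non-zero Lie brackets of basis vectors (up to anti-symmetry) being $$[e_1,e_2]=\epsilon a\,e_3,\quad [e_2,e_3]=\epsilon a\,e_1,\quad [e_3,e_1]=\epsilon a\,e_2,\quad [e_3,e_4]=b\,e_2,\quad [e_4,e_2]=b\,e_3,$$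 and such that, if $b\ne0$, then $\delta(e_1)=-\epsilon\,\delta(e^1)$ and $\delta$ vanishes on $\operatorname{span}\{e_2,e_3,e^2,e^3\}$, while, if $b=0$, then $\delta(e_i)=-\epsilon\,\delta(e^i)$ for $i=1,2,3$. Conversely, every tuple as in (i), (ii) or (iii) is a generalised Einstein Riemannian Lie algebra. -/

import Mathlib

attribute [local instance 100] LieRing.ofAssociativeRing

/-- The Lie algebra `e(2)` of the group of rigid motions of the Euclidean plane: the real matrices
`[[A, v], [0, 0]]` with `A` a skew-symmetric `2 × 2` matrix and `v` a vector in the plane. -/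
def euclideanLieAlgebra2 : LieSubalgebra ℝ (Matrix (Fin 3) (Fin 3) ℝ) where
  carrier := {A | A 0 0 = 0 ∧ A 1 1 = 0 ∧ A 0 1 = -A 1 0 ∧ ∀ j, A 2 j = 0}
  zero_mem' := by simp
  add_mem' := by
    rintro A B ⟨h1, h2, h3, h4⟩ ⟨k1, k2, k3, k4⟩
    refine ⟨by simp [h1, k1], by simp [h2, k2], ?_, fun j => by simp [h4, k4]⟩
    simp only [Matrix.add_apply, h3, k3]; ring
  smul_mem' := by
    rintro c A ⟨h1, h2, h3, h4⟩
    exact ⟨by simp [h1], by simp [h2], by simp [h3], fun j => by simp [h4]⟩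
  lie_mem' := by
    rintro A B ⟨h1, h2, h3, h4⟩ ⟨k1, k2, k3, k4⟩
    simp only [Set.mem_ofPred_eq, Ring.lie_def, Matrix.sub_apply, Matrix.mul_apply,
      Fin.sum_univ_three, h1, h2, h3, h4, k1, k2, k3, k4]
    refine ⟨by ring, by ring, by ring, fun j => by ring⟩

noncomputable section

/-- The generalised tangent space `E = 𝔤 ⊕ 𝔤*`. -/
abbrev GenTangent (𝔤 : Type*) [AddCommGroup 𝔤] [Module ℝ 𝔤] : Type _ :=
  𝔤 × Module.Dual ℝ 𝔤

/-- The pairing `⟨X + ξ, Y + η⟩ = (η(X) + ξ(Y)) / 2` on `E`. -/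
def genPairing {𝔤 : Type*} [AddCommGroup 𝔤] [Module ℝ 𝔤] (x y : GenTangent 𝔤) : ℝ :=
  (1 / 2) * (y.2 x.1 + x.2 y.1)

/-- The covector `H(X, Y, ·)`. -/
def contract {𝔤 : Type*} [AddCommGroup 𝔤] [Module ℝ 𝔤] (H : 𝔤 [⋀^Fin 3]→ₗ[ℝ] ℝ) (X Y : 𝔤) :
    Module.Dual ℝ 𝔤 where
  toFun Z := H ![X, Y, Z]
  map_add' Z W := by
    have h : ∀ V : 𝔤, ![X, Y, V] = Function.update ![X, Y, 0] 2 V := by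
      intro V; ext i; fin_cases i <;> rfl
    rw [h, h Z, h W, H.map_update_add]
  map_smul' c Z := by
    have h : ∀ V : 𝔤, ![X, Y, V] = Function.update ![X, Y, 0] 2 V := by
      intro V; ext i; fin_cases i <;> rfl
    rw [h, h Z, H.map_update_smul]; rfl

theorem contract_apply {𝔤 : Type*} [AddCommGroup 𝔤] [Module ℝ 𝔤] (H : 𝔤 [⋀^Fin 3]→ₗ[ℝ] ℝ)
    (X Y Z : 𝔤) : contract H X Y Z = H ![X, Y, Z] := rfl

theorem contract_add_left {𝔤 : Type*} [AddCommGroup 𝔤] [Module ℝ 𝔤] (H : 𝔤 [⋀^Fin 3]→ₗ[ℝ] ℝ)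
    (X X' Y : 𝔤) : contract H (X + X') Y = contract H X Y + contract H X' Y := by
  ext Z
  exact H.toMultilinearMap.cons_add ![Y, Z] X X'

theorem contract_smul_left {𝔤 : Type*} [AddCommGroup 𝔤] [Module ℝ 𝔤] (H : 𝔤 [⋀^Fin 3]→ₗ[ℝ] ℝ)
    (c : ℝ) (X Y : 𝔤) : contract H (c • X) Y = c • contract H X Y := by
  ext Z
  exact H.toMultilinearMap.cons_smul ![Y, Z] c X

theorem contract_add_right {𝔤 : Type*} [AddCommGroup 𝔤] [Module ℝ 𝔤] (H : 𝔤 [⋀^Fin 3]→ₗ[ℝ] ℝ)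
    (X Y Y' : 𝔤) : contract H X (Y + Y') = contract H X Y + contract H X Y' := by
  ext Z
  have h : ∀ V : 𝔤, ![X, V, Z] = Function.update ![X, 0, Z] 1 V := by
    intro V; ext i; fin_cases i <;> rfl
  simp only [LinearMap.add_apply, contract_apply]
  rw [h, h Y, h Y', H.map_update_add]

theorem contract_smul_right {𝔤 : Type*} [AddCommGroup 𝔤] [Module ℝ 𝔤]
    (H : 𝔤 [⋀^Fin 3]→ₗ[ℝ] ℝ) (c : ℝ) (X Y : 𝔤) :
    contract H X (c • Y) = c • contract H X Y := by
  ext Z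
  have h : ∀ V : 𝔤, ![X, V, Z] = Function.update ![X, 0, Z] 1 V := by
    intro V; ext i; fin_cases i <;> rfl
  simp only [LinearMap.smul_apply, contract_apply]
  rw [h, h Y, H.map_update_smul]

/-- The three-form `α ∧ β ∧ γ`, normalised so that `e^{123}(e₁, e₂, e₃) = 1`. -/
def wedge3 {𝔤 : Type*} [AddCommGroup 𝔤] [Module ℝ 𝔤] (α β γ : Module.Dual ℝ 𝔤) :
    𝔤 [⋀^Fin 3]→ₗ[ℝ] ℝ :=
  Matrix.detRowAlternating.compLinearMap (LinearMap.pi ![α, β, γ])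

/-- Closedness of a three-form on a Lie algebra: its Chevalley–Eilenberg differential
`dH(X₀, …, X₃) = ∑_{i < j} (-1)^{i+j} H([Xᵢ, Xⱼ], …)` vanishes. -/
def IsClosed3Form {𝔤 : Type*} [LieRing 𝔤] [LieAlgebra ℝ 𝔤] (H : 𝔤 [⋀^Fin 3]→ₗ[ℝ] ℝ) : Prop :=
  ∀ X Y Z W : 𝔤,
    -H ![⁅X, Y⁆, Z, W] + H ![⁅X, Z⁆, Y, W] - H ![⁅X, W⁆, Y, Z]
      - H ![⁅Y, Z⁆, X, W] + H ![⁅Y, W⁆, X, Z] - H ![⁅Z, W⁆, X, Y] = 0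

/-- A generalised pseudo-Riemannian metric `(H, 𝒢_g)` on the Lie algebra `𝔤`, given by a
pseudo-Riemannian metric `g` and a closed three-form `H`. -/
structure GenMetric (𝔤 : Type*) [LieRing 𝔤] [LieAlgebra ℝ 𝔤] where
  g : LinearMap.BilinForm ℝ 𝔤
  symm : g.IsSymm
  nondegenerate : g.Nondegenerate
  H : 𝔤 [⋀^Fin 3]→ₗ[ℝ] ℝ
  closed : IsClosed3Form H

namespace GenMetric

variable {𝔤 : Type*} [LieRing 𝔤] [LieAlgebra ℝ 𝔤]

/-- `(H, 𝒢_g)` is Riemannian: `g` is positive definite. -/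
def IsRiemannian (M : GenMetric 𝔤) : Prop :=
  ∀ X : 𝔤, X ≠ 0 → 0 < M.g X X

/-- The `H`-twisted Dorfman bracket
`[X + ξ, Y + η]_H = [X, Y] + X ⌟ dη - Y ⌟ dξ + H(X, Y, ·)` on `E`, where
`dξ(X, Y) = -ξ([X, Y])`. -/
def dorfman (M : GenMetric 𝔤) : GenTangent 𝔤 →ₗ[ℝ] GenTangent 𝔤 →ₗ[ℝ] GenTangent 𝔤 :=
  LinearMap.mk₂ ℝ
    (fun x y => (⁅x.1, y.1⁆,
      -(y.2 ∘ₗ (LieAlgebra.ad ℝ 𝔤 x.1 : 𝔤 →ₗ[ℝ] 𝔤))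
        + x.2 ∘ₗ (LieAlgebra.ad ℝ 𝔤 y.1 : 𝔤 →ₗ[ℝ] 𝔤) + contract M.H x.1 y.1))
    (by
      intro x x' y
      refine Prod.ext (by simp) ?_
      ext Z
      simp [contract_add_left]; ring)
    (by
      intro c x y
      refine Prod.ext (by simp) ?_
      ext Z
      simp [contract_smul_left])
    (by
      intro x y y'
      refine Prod.ext (by simp) ?_
      ext Z
      simp [contract_add_right]; ring)
    (by
      intro c x y
      refine Prod.ext (by simp) ?_
      ext Z
      simp [contract_smul_right])

variable [FiniteDimensional ℝ 𝔤]

/-- The generalised metric `𝒢_g (X + ξ) = g⁻¹ ξ + g X` as an endomorphism of `E`. -/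
def gen (M : GenMetric 𝔤) : GenTangent 𝔤 →ₗ[ℝ] GenTangent 𝔤 :=
  LinearMap.prod
    ((M.g.toDual M.nondegenerate).symm.toLinearMap ∘ₗ LinearMap.snd ℝ 𝔤 (Module.Dual ℝ 𝔤))
    ((M.g.toDual M.nondegenerate).toLinearMap ∘ₗ LinearMap.fst ℝ 𝔤 (Module.Dual ℝ 𝔤))

theorem gen_gen (M : GenMetric 𝔤) (x : GenTangent 𝔤) : M.gen (M.gen x) = x := by
  simp [gen]

/-- The eigenspaces `E_+` (for `σ = 1`) and `E_-` (for `σ = -1`) of `𝒢_g`. -/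
abbrev eigen (M : GenMetric 𝔤) (σ : ℤˣ) : Submodule ℝ (GenTangent 𝔤) :=
  Module.End.eigenspace M.gen (((σ : ℤ) : ℝ))

/-- The projections `π_± = (1 ± 𝒢_g) / 2` of `E` onto `E_±` along `E_∓`. -/
def proj (M : GenMetric 𝔤) (σ : ℤˣ) : GenTangent 𝔤 →ₗ[ℝ] M.eigen σ :=
  LinearMap.codRestrict (M.eigen σ)
    ((1 / 2 : ℝ) • (LinearMap.id + ((σ : ℤ) : ℝ) • M.gen))
    (by
      intro x
      rw [Module.End.mem_eigenspace_iff]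
      rcases Int.units_eq_one_or σ with rfl | rfl <;>
        simp [gen_gen, smul_add, add_comm])

/-- `D` is a generalised Levi-Civita connection of `𝒢_g`; here `D a b` is `D_a b`. The clauses say
that `D` is compatible with the pairing, that it is torsion-free, and that `D 𝒢_g = 0`. The torsion
`T_D(a, b) = D_a b - D_b a - [a, b]_H + (D a)^* b` is tested against an arbitrary `c ∈ E`, where
`⟨(D a)^* b, c⟩ = ⟨b, D_c a⟩` by definition of the adjoint. -/
structure IsLeviCivita (M : GenMetric 𝔤)
    (D : GenTangent 𝔤 →ₗ[ℝ] GenTangent 𝔤 →ₗ[ℝ] GenTangent 𝔤) : Prop where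
  pairing : ∀ a b c, genPairing (D a b) c + genPairing b (D a c) = 0
  torsion : ∀ a b c,
    genPairing (D a b - D b a - M.dorfman a b) c + genPairing b (D c a) = 0
  metric : ∀ a, D a ∘ₗ M.gen = M.gen ∘ₗ D a

/-- The divergence operator `δ_D(e) = tr(D e)` of `D`, where `D e` is the map `a ↦ D_a e`. -/
def divergence (D : GenTangent 𝔤 →ₗ[ℝ] GenTangent 𝔤 →ₗ[ℝ] GenTangent 𝔤) :
    Module.Dual ℝ (GenTangent 𝔤) :=
  LinearMap.trace ℝ (GenTangent 𝔤) ∘ₗ D.flip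

/-- The map `a ↦ R_D(a, b) c = D_a D_b c - D_b D_a c - D_{[a, b]_H} c`. -/
def curvature (M : GenMetric 𝔤) (D : GenTangent 𝔤 →ₗ[ℝ] GenTangent 𝔤 →ₗ[ℝ] GenTangent 𝔤)
    (b c : GenTangent 𝔤) : GenTangent 𝔤 →ₗ[ℝ] GenTangent 𝔤 :=
  D.flip (D b c) - D b ∘ₗ D.flip c - D.flip c ∘ₗ M.dorfman.flip b

/-- The generalised Ricci curvatures
`RC^±_D(b, c) = tr(E_± ∋ a ↦ R_D(a, b) c ∈ E_±)` for `b ∈ E_∓` and `c ∈ E_±`. For metric `D` the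
map takes values in `E_±`, so that the projection only adjusts the codomain. -/
def ricci (M : GenMetric 𝔤) (D : GenTangent 𝔤 →ₗ[ℝ] GenTangent 𝔤 →ₗ[ℝ] GenTangent 𝔤)
    (σ : ℤˣ) (b : M.eigen (-σ)) (c : M.eigen σ) : ℝ :=
  LinearMap.trace ℝ (M.eigen σ)
    (M.proj σ ∘ₗ M.curvature D b c ∘ₗ (M.eigen σ).subtype)

/-- `(𝔤, H, 𝒢_g, δ)` is generalised Einstein: the generalised Ricci curvature of `(𝒢_g, δ)`, i.e.
that of any generalised Levi-Civita connection of `𝒢_g` with divergence operator `δ` (and there is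
such a connection), vanishes. As `RC_D = RC^+_D - RC^-_D` lies in
`(E_- ⊗ E_+)^* ⊕ (E_+ ⊗ E_-)^*`, it vanishes if and only if both `RC^+_D` and `RC^-_D` do. -/
def IsGenEinstein (M : GenMetric 𝔤) (δ : Module.Dual ℝ (GenTangent 𝔤)) : Prop :=
  (∃ D, M.IsLeviCivita D ∧ divergence D = δ) ∧
    ∀ D, M.IsLeviCivita D → divergence D = δ →
      ∀ (σ : ℤˣ) (b : M.eigen (-σ)) (c : M.eigen σ), M.ricci D σ b c = 0

end GenMetric

/-- `(𝔤, H, 𝒢_g, δ)` and `(𝔥, H', 𝒢_{g'}, δ')` are isomorphic: there is an isomorphism of Lie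
algebras `f : 𝔤 → 𝔥` such that `f` identifies `g` with `g'` and `H` with `H'`, and the induced
isomorphism `X + ξ ↦ f(X) + ξ ∘ f⁻¹` of `E` identifies `δ` with `δ'`. -/
def GenIsomorphic {𝔤 𝔥 : Type*} [LieRing 𝔤] [LieAlgebra ℝ 𝔤] [LieRing 𝔥] [LieAlgebra ℝ 𝔥]
    (M : GenMetric 𝔤) (δ : Module.Dual ℝ (GenTangent 𝔤))
    (M' : GenMetric 𝔥) (δ' : Module.Dual ℝ (GenTangent 𝔥)) : Prop :=
  ∃ f : 𝔤 ≃ₗ⁅ℝ⁆ 𝔥,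
    (∀ X Y, M'.g (f X) (f Y) = M.g X Y) ∧
    (∀ X Y Z, M'.H ![f X, f Y, f Z] = M.H ![X, Y, Z]) ∧
    (∀ (X : 𝔤) (ξ : Module.Dual ℝ 𝔤),
      δ' (f X, ξ ∘ₗ (f.symm : 𝔥 →ₗ[ℝ] 𝔤)) = δ (X, ξ))

/-- `e` is an orthonormal basis for the positive definite form `g`. -/
def IsOrthonormalBasis {𝔤 : Type*} [LieRing 𝔤] [LieAlgebra ℝ 𝔤] (g : LinearMap.BilinForm ℝ 𝔤)
    (e : Module.Basis (Fin 4) ℝ 𝔤) : Prop :=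
  ∀ i j, g (e i) (e j) = if i = j then 1 else 0

/-- A vector `X ∈ 𝔤` as the element `Y + η ↦ η(X)` of `E*`. -/
def vecFunctional {𝔤 : Type*} [AddCommGroup 𝔤] [Module ℝ 𝔤] (X : 𝔤) :
    Module.Dual ℝ (GenTangent 𝔤) :=
  Module.Dual.eval ℝ 𝔤 X ∘ₗ LinearMap.snd ℝ 𝔤 (Module.Dual ℝ 𝔤)

/-- A covector `ξ ∈ 𝔤*` as the element `Y + η ↦ ξ(Y)` of `E*`. -/
def covecFunctional {𝔤 : Type*} [AddCommGroup 𝔤] [Module ℝ 𝔤] (ξ : Module.Dual ℝ 𝔤) :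
    Module.Dual ℝ (GenTangent 𝔤) :=
  ξ ∘ₗ LinearMap.fst ℝ 𝔤 (Module.Dual ℝ 𝔤)

/-- Family (i): the Abelian Lie algebra `ℝ⁴` with `H = 0`, an arbitrary Riemannian metric and an
arbitrary divergence operator. -/
def FamilyAbelian (M : GenMetric (Fin 4 → ℝ)) (_δ : Module.Dual ℝ (GenTangent (Fin 4 → ℝ))) :
    Prop :=
  M.IsRiemannian ∧ M.H = 0

/-- Family (ii), on `e(2) ⊕ ℝ`; the basis `(e₁, …, e₄)` is indexed from `0` to `3`. -/
def FamilyEuclidean (M : GenMetric (euclideanLieAlgebra2 × ℝ))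
    (δ : Module.Dual ℝ (GenTangent (euclideanLieAlgebra2 × ℝ))) : Prop :=
  M.H = 0 ∧
  ∃ (e : Module.Basis (Fin 4) ℝ (euclideanLieAlgebra2 × ℝ)) (a : ℝ),
    IsOrthonormalBasis M.g e ∧ 0 < a ∧
    ⁅e 2, e 0⁆ = a • e 1 ∧ ⁅e 2, e 1⁆ = -(a • e 0) ∧
    ⁅e 0, e 1⁆ = 0 ∧ ⁅e 0, e 3⁆ = 0 ∧ ⁅e 1, e 3⁆ = 0 ∧ ⁅e 2, e 3⁆ = 0 ∧
    δ ∈ Submodule.span ℝ {vecFunctional (e 2), vecFunctional (e 3),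
      covecFunctional (e.coord 2), covecFunctional (e.coord 3)}

/-- Family (iii), on `so(3) ⊕ ℝ`; the basis `(e₁, …, e₄)` is indexed from `0` to `3`. -/
def FamilyOrthogonal (M : GenMetric (LieAlgebra.Orthogonal.so (Fin 3) ℝ × ℝ))
    (δ : Module.Dual ℝ (GenTangent (LieAlgebra.Orthogonal.so (Fin 3) ℝ × ℝ))) : Prop :=
  ∃ (e : Module.Basis (Fin 4) ℝ (LieAlgebra.Orthogonal.so (Fin 3) ℝ × ℝ)) (a b ε : ℝ),
    IsOrthonormalBasis M.g e ∧ a ≠ 0 ∧ (ε = 1 ∨ ε = -1) ∧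
    M.H = a • wedge3 (e.coord 0) (e.coord 1) (e.coord 2) ∧
    ⁅e 0, e 1⁆ = (ε * a) • e 2 ∧ ⁅e 1, e 2⁆ = (ε * a) • e 0 ∧ ⁅e 2, e 0⁆ = (ε * a) • e 1 ∧
    ⁅e 2, e 3⁆ = b • e 1 ∧ ⁅e 3, e 1⁆ = b • e 2 ∧ ⁅e 0, e 3⁆ = 0 ∧
    (b ≠ 0 →
      δ (e 0, 0) = -ε * δ (0, e.coord 0) ∧
      ∀ i ∈ ({1, 2} : Set (Fin 4)), δ (e i, 0) = 0 ∧ δ (0, e.coord i) = 0) ∧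
    (b = 0 →
      ∀ i ∈ ({0, 1, 2} : Set (Fin 4)), δ (e i, 0) = -ε * δ (0, e.coord i))

end

/-! On left-invariant objects, closedness of $H$ makes the Dorfman bracket a Lie bracket on $E$ for
which $F(x,y,z)=\langle[x,y]_H,z\rangle$ is totally skew and invariant. Write $a_i,u_i$ for the
frames $e_i\pm e^i$ of $E_\pm$. Torsion-freeness forces $D_ab=\pi_\pm[a,b]_H$ for $a\in E_\mp$,
$b\in E_\pm$, while the undetermined pure-type part of $D$ enters the Ricci curvature only through
the divergence (`IsLeviCivita.ricci_eq`). Since every $\delta$ is a divergence, being Einstein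
becomes an equation between structure constants, components of $H$ and $\delta$
(`isGenEinstein_iff`).

The decisive step removes $\delta$. Let $R_{ij}$ be the part of the Ricci curvature that is
quadratic in $F$. Invariance of $F$ gives $\sum_{ij}F(u_i,a_j,x)R_{ij}=0$ for every $x\in E$
(`sum_dorfmanForm_mul_frameRicci`). The Einstein equation reads $F(u_i,a_j,x)=-R_{ij}$ for the $x\in
E_+$ built from $\delta$, so $\sum R_{ij}^2=0$ and $R=0$.

A four-dimensional real Lie algebra is never perfect (`exists_dual_lie_eq_zero`), so there is a unit
vector $e_4\perp[\mathfrak g,\mathfrak g]$. For such a vector $R_{44}$ is minus a sum of squares, so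
$\mathrm{ad}_{e_4}$ is skew and $e_4\lrcorner H=0$; in particular $\mathfrak g$ is unimodular. The
bracket on $e_4^\perp$ is then encoded by a symmetric $3\times3$ matrix $m$, and $R=0$ says
$\operatorname{adj}m=\tfrac14h^2I$ with $H=h\,e^{123}$ (`IsGenEinstein.normal_form`).

If $h=0$, then $m$ has rank at most one. This yields a second direction orthogonal to the
commutators, so everything is a rotation of a plane: $\mathbb R^4$ or $\mathfrak e(2)\oplus\mathbb
R$. If $h\ne0$, then $m=\pm\tfrac h2I$, and $e_1$ is chosen in the kernel of $\mathrm{ad}_{e_4}$,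
giving $\mathfrak{so}(3)\oplus\mathbb R$. What remains of the Einstein equation is linear in
$\delta$; it is solved as an equivalence, which also proves the converse. Equal structure constants
then identify the algebra with its matrix model. -/

noncomputable section

/-! ### The Dorfman bracket as a quadratic Lie algebra, and frames of E. -/

/-- The pairing of `E` as a bilinear form. -/
def genForm (𝔤 : Type*) [AddCommGroup 𝔤] [Module ℝ 𝔤] : LinearMap.BilinForm ℝ (GenTangent 𝔤) :=
  LinearMap.mk₂ ℝ genPairing
    (by intro x x' y; simp [genPairing]; ring)
    (by intro c x y; simp [genPairing]; ring)
    (by intro x y y'; simp [genPairing]; ring)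
    (by intro c x y; simp [genPairing]; ring)

theorem genForm_apply {𝔤 : Type*} [AddCommGroup 𝔤] [Module ℝ 𝔤] (x y : GenTangent 𝔤) :
    genForm 𝔤 x y = (1 / 2) * (y.2 x.1 + x.2 y.1) := rfl

theorem genPairing_eq_genForm {𝔤 : Type*} [AddCommGroup 𝔤] [Module ℝ 𝔤] (x y : GenTangent 𝔤) :
    genPairing x y = genForm 𝔤 x y := rfl

theorem genForm_comm {𝔤 : Type*} [AddCommGroup 𝔤] [Module ℝ 𝔤] (x y : GenTangent 𝔤) :
    genForm 𝔤 x y = genForm 𝔤 y x := by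
  simp only [genForm_apply]; ring

theorem genForm_sub_left {𝔤 : Type*} [AddCommGroup 𝔤] [Module ℝ 𝔤] (x y z : GenTangent 𝔤) :
    genForm 𝔤 (x - y) z = genForm 𝔤 x z - genForm 𝔤 y z := by
  simp only [map_sub, LinearMap.sub_apply]

theorem alternating_swap_left {𝔤 : Type*} [AddCommGroup 𝔤] [Module ℝ 𝔤]
    (H : 𝔤 [⋀^Fin 3]→ₗ[ℝ] ℝ) (X Y Z : 𝔤) : H ![Y, X, Z] = -H ![X, Y, Z] := by
  rw [← H.map_swap ![X, Y, Z] (show (0 : Fin 3) ≠ 1 by decide)]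
  congr 1; ext i; fin_cases i <;> simp [Equiv.swap_apply_of_ne_of_ne]

theorem alternating_swap_right {𝔤 : Type*} [AddCommGroup 𝔤] [Module ℝ 𝔤]
    (H : 𝔤 [⋀^Fin 3]→ₗ[ℝ] ℝ) (X Y Z : 𝔤) : H ![X, Z, Y] = -H ![X, Y, Z] := by
  rw [← H.map_swap ![X, Y, Z] (show (1 : Fin 3) ≠ 2 by decide)]
  congr 1; ext i; fin_cases i <;> simp [Equiv.swap_apply_of_ne_of_ne]

namespace GenMetric

variable {𝔤 : Type*} [LieRing 𝔤] [LieAlgebra ℝ 𝔤]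

theorem dorfman_fst (M : GenMetric 𝔤) (x y : GenTangent 𝔤) : (M.dorfman x y).1 = ⁅x.1, y.1⁆ := rfl

theorem dorfman_snd (M : GenMetric 𝔤) (x y : GenTangent 𝔤) (Z : 𝔤) :
    (M.dorfman x y).2 Z = -y.2 ⁅x.1, Z⁆ + x.2 ⁅y.1, Z⁆ + M.H ![x.1, y.1, Z] := rfl

/-- The trilinear form `⟨[x, y]_H, z⟩`. -/
def dorfmanForm (M : GenMetric 𝔤) :
    GenTangent 𝔤 →ₗ[ℝ] GenTangent 𝔤 →ₗ[ℝ] GenTangent 𝔤 →ₗ[ℝ] ℝ :=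
  M.dorfman.compr₂ (genForm 𝔤)

theorem dorfmanForm_def (M : GenMetric 𝔤) (x y z : GenTangent 𝔤) :
    M.dorfmanForm x y z = genForm 𝔤 (M.dorfman x y) z := rfl

/-- The right-hand side is visibly invariant under cyclic permutations. Total skew-symmetry of the
form follows from this and one transposition. -/
theorem dorfmanForm_apply (M : GenMetric 𝔤) (x y z : GenTangent 𝔤) :
    M.dorfmanForm x y z =
      (1 / 2) * (z.2 ⁅x.1, y.1⁆ + x.2 ⁅y.1, z.1⁆ + y.2 ⁅z.1, x.1⁆ + M.H ![x.1, y.1, z.1]) := by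
  rw [dorfmanForm_def, genForm_apply, dorfman_snd, dorfman_fst, ← lie_skew z.1 x.1, map_neg]; ring

theorem dorfmanForm_swap_left (M : GenMetric 𝔤) (x y z : GenTangent 𝔤) :
    M.dorfmanForm y x z = -M.dorfmanForm x y z := by
  simp only [dorfmanForm_apply]
  rw [← lie_skew y.1 x.1, ← lie_skew x.1 z.1, ← lie_skew z.1 y.1, alternating_swap_left M.H x.1 y.1]
  simp only [map_neg]; ring

theorem dorfmanForm_cycle (M : GenMetric 𝔤) (x y z : GenTangent 𝔤) :
    M.dorfmanForm y z x = M.dorfmanForm x y z := by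
  simp only [dorfmanForm_apply]
  rw [alternating_swap_right M.H y.1 x.1 z.1, alternating_swap_left M.H x.1 y.1]
  ring

theorem dorfmanForm_swap_right (M : GenMetric 𝔤) (x y z : GenTangent 𝔤) :
    M.dorfmanForm x z y = -M.dorfmanForm x y z := by
  rw [← M.dorfmanForm_cycle x z y, dorfmanForm_swap_left, dorfmanForm_cycle, dorfmanForm_cycle]

/-- The vector part and the terms linear in the covectors are the Jacobi identity of `𝔤`. The
remaining terms involve only `H` and are exactly its closedness. -/
theorem dorfman_jacobi (M : GenMetric 𝔤) (x y z : GenTangent 𝔤) :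
    M.dorfman x (M.dorfman y z) = M.dorfman (M.dorfman x y) z + M.dorfman y (M.dorfman x z) := by
  refine Prod.ext ?_ ?_
  · simp [dorfman_fst]
  · ext W
    have h := M.closed x.1 y.1 z.1 W
    simp only [Prod.snd_add, LinearMap.add_apply, dorfman_snd, dorfman_fst]
    have h1 := alternating_swap_left M.H x.1 ⁅y.1, z.1⁆ W
    have h2 := alternating_swap_right M.H y.1 z.1 ⁅x.1, W⁆
    have h3 := alternating_swap_left M.H y.1 ⁅x.1, z.1⁆ W
    have e1 : ∀ (A B C D : 𝔤), M.H ![B, C, A] = M.H ![A, B, C] := by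
      intro A B C D
      rw [alternating_swap_right M.H B A C, alternating_swap_left M.H A B]; ring
    have h5 := e1 ⁅x.1, W⁆ y.1 z.1 0
    have h6 := e1 ⁅y.1, W⁆ x.1 z.1 0
    have h7 := e1 ⁅z.1, W⁆ x.1 y.1 0
    have j1 : z.2 ⁅⁅x.1, y.1⁆, W⁆ = z.2 ⁅x.1, ⁅y.1, W⁆⁆ - z.2 ⁅y.1, ⁅x.1, W⁆⁆ := by
      rw [← map_sub, lie_lie]
    have j2 : y.2 ⁅⁅x.1, z.1⁆, W⁆ = y.2 ⁅x.1, ⁅z.1, W⁆⁆ - y.2 ⁅z.1, ⁅x.1, W⁆⁆ := by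
      rw [← map_sub, lie_lie]
    have j3 : x.2 ⁅⁅y.1, z.1⁆, W⁆ = x.2 ⁅y.1, ⁅z.1, W⁆⁆ - x.2 ⁅z.1, ⁅y.1, W⁆⁆ := by
      rw [← map_sub, lie_lie]
    linarith

theorem dorfmanForm_invariant (M : GenMetric 𝔤) (x y z w : GenTangent 𝔤) :
    M.dorfmanForm (M.dorfman x y) z w + M.dorfmanForm y (M.dorfman x z) w
      + M.dorfmanForm y z (M.dorfman x w) = 0 := by
  have h : M.dorfmanForm x (M.dorfman y z) w =
      M.dorfmanForm (M.dorfman x y) z w + M.dorfmanForm y (M.dorfman x z) w := by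
    rw [dorfmanForm_def, dorfman_jacobi, map_add, LinearMap.add_apply]; rfl
  have h' : M.dorfmanForm y z (M.dorfman x w) = M.dorfmanForm x w (M.dorfman y z) := by
    simp only [dorfmanForm_def]; rw [genForm_comm]
  rw [← h, h', dorfmanForm_swap_right M x w]; ring

end GenMetric

section Frame

variable {𝔤 : Type*} [LieRing 𝔤] [LieAlgebra ℝ 𝔤]

/-- The vectors `e_i + s e^i` of `E`. -/
def frameVec (e : Module.Basis (Fin 4) ℝ 𝔤) (s : ℝ) (i : Fin 4) : GenTangent 𝔤 :=
  (e i, s • e.coord i)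

variable (e : Module.Basis (Fin 4) ℝ 𝔤)

theorem genForm_frameVec (s : ℝ) (i : Fin 4) (x : GenTangent 𝔤) :
    genForm 𝔤 x (frameVec e s i) = (1 / 2) * (s * e.coord i x.1 + x.2 (e i)) := by
  simp [genForm_apply, frameVec]

theorem genForm_frameVec_frameVec (s t : ℝ) (i j : Fin 4) :
    genForm 𝔤 (frameVec e s i) (frameVec e t j) = if i = j then (1 / 2) * (s + t) else 0 := by
  rw [genForm_frameVec]
  simp only [frameVec, LinearMap.smul_apply, Module.Basis.coord_apply, Module.Basis.repr_self,
    Finsupp.single_apply, smul_eq_mul]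
  by_cases h : i = j
  · subst h; simp; ring
  · simp [h, Ne.symm h]

/-- The frames for `s` and `-s` are mutually orthogonal and have square norms `s` and `-s`, which
explains the signs. Allowing both values of `s` treats `E_+` and `E_-` at once. -/
theorem frameVec_expansion {s : ℝ} (hs : s * s = 1) (x : GenTangent 𝔤) :
    x = s • ∑ i, genForm 𝔤 x (frameVec e s i) • frameVec e s i
      + (-s) • ∑ i, genForm 𝔤 x (frameVec e (-s) i) • frameVec e (-s) i := by
  simp only [genForm_frameVec]
  refine Prod.ext ?_ ?_
  · simp only [frameVec, Prod.fst_add, Prod.smul_fst, Prod.fst_sum, Finset.smul_sum, smul_smul,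
      ← Finset.sum_add_distrib, ← add_smul]
    conv_lhs => rw [← e.sum_repr x.1]
    refine Finset.sum_congr rfl fun i _ => ?_
    congr 1
    simp only [Module.Basis.coord_apply]
    linear_combination (-(e.repr x.1 i)) * hs
  · refine e.ext fun j => ?_
    simp only [frameVec, Prod.snd_add, Prod.smul_snd, Prod.snd_sum, LinearMap.add_apply,
      LinearMap.smul_apply, LinearMap.sum_apply, Module.Basis.coord_apply, Module.Basis.repr_self,
      Finsupp.single_apply, smul_eq_mul, Finset.mul_sum, ← Finset.sum_add_distrib]
    rw [Finset.sum_eq_single j (fun i _ hi => by simp [Ne.symm hi]) (by simp)]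
    simp only [if_true]
    linear_combination (-(x.2 (e j))) * hs

theorem trace_eq_sum_genForm [FiniteDimensional ℝ 𝔤] {s : ℝ} (hs : s * s = 1)
    (T : GenTangent 𝔤 →ₗ[ℝ] GenTangent 𝔤) :
    LinearMap.trace ℝ _ T =
      s * ∑ i, genForm 𝔤 (T (frameVec e s i)) (frameVec e s i)
      - s * ∑ i, genForm 𝔤 (T (frameVec e (-s) i)) (frameVec e (-s) i) := by
  have h : T = s • ∑ i, (genForm 𝔤 (frameVec e s i)).smulRight (T (frameVec e s i))
      + (-s) • ∑ i, (genForm 𝔤 (frameVec e (-s) i)).smulRight (T (frameVec e (-s) i)) := by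
    refine LinearMap.ext fun x => ?_
    conv_lhs => rw [frameVec_expansion e hs x]
    simp only [map_add, map_smul, map_sum, LinearMap.add_apply, LinearMap.smul_apply,
      LinearMap.sum_apply, LinearMap.smulRight_apply, genForm_comm x]
  refine (congrArg (LinearMap.trace ℝ (GenTangent 𝔤)) h).trans ?_
  simp only [map_add, map_smul, map_sum, LinearMap.trace_smulRight, smul_eq_mul,
    genForm_comm (frameVec e _ _)]
  ring

end Frame

end

/-! ### Generalised Levi-Civita connections and their Ricci curvature in a frame. -/

noncomputable section

namespace GenMetric

variable {𝔤 : Type*} [LieRing 𝔤] [LieAlgebra ℝ 𝔤] [FiniteDimensional ℝ 𝔤]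

theorem gen_eq (M : GenMetric 𝔤) (x : GenTangent 𝔤) :
    M.gen x = ((M.g.toDual M.nondegenerate).symm x.2, M.g.toDual M.nondegenerate x.1) := rfl

theorem genForm_gen (M : GenMetric 𝔤) (x y : GenTangent 𝔤) :
    genForm 𝔤 (M.gen x) y = genForm 𝔤 x (M.gen y) := by
  have h : ∀ ξ η : Module.Dual ℝ 𝔤, η ((M.g.toDual M.nondegenerate).symm ξ) =
      ξ ((M.g.toDual M.nondegenerate).symm η) := by
    intro ξ η
    conv_lhs => rw [← (M.g.toDual M.nondegenerate).apply_symm_apply η]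
    conv_rhs => rw [← (M.g.toDual M.nondegenerate).apply_symm_apply ξ]
    rw [LinearMap.BilinForm.toDual_def, LinearMap.BilinForm.toDual_def]
    exact M.symm.eq _ _
  have h' : M.g x.1 y.1 = M.g y.1 x.1 := M.symm.eq _ _
  simp only [genForm_apply, gen_eq, LinearMap.BilinForm.toDual_def]
  rw [h x.2 y.2, h']
  ring

theorem genForm_eq_zero_of_gen (M : GenMetric 𝔤) {s : ℝ} (hs : s ≠ 0) {x y : GenTangent 𝔤}
    (hx : M.gen x = s • x) (hy : M.gen y = (-s) • y) : genForm 𝔤 x y = 0 := by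
  have h := M.genForm_gen x y
  rw [hx, hy, map_smul, LinearMap.smul_apply, map_smul, smul_eq_mul, smul_eq_mul] at h
  have : s * genForm 𝔤 x y = 0 := by linarith
  exact (mul_eq_zero.1 this).resolve_left hs

theorem toDual_orthonormal (M : GenMetric 𝔤) {e : Module.Basis (Fin 4) ℝ 𝔤}
    (he : IsOrthonormalBasis M.g e) (i : Fin 4) :
    M.g.toDual M.nondegenerate (e i) = e.coord i := by
  refine e.ext fun j => ?_
  rw [LinearMap.BilinForm.toDual_def, he i j]
  simp [Finsupp.single_apply, eq_comm]

theorem gen_frameVec (M : GenMetric 𝔤) {e : Module.Basis (Fin 4) ℝ 𝔤}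
    (he : IsOrthonormalBasis M.g e) {s : ℝ} (hs : s * s = 1) (i : Fin 4) :
    M.gen (frameVec e s i) = s • frameVec e s i := by
  rw [gen_eq, frameVec]
  refine Prod.ext ?_ ?_
  · simp only [map_smul, Prod.smul_fst]
    rw [← M.toDual_orthonormal he i, LinearEquiv.symm_apply_apply]
  · simp only [Prod.smul_snd, smul_smul, hs, one_smul]
    exact M.toDual_orthonormal he i

theorem expansion_of_gen (M : GenMetric 𝔤) {e : Module.Basis (Fin 4) ℝ 𝔤}
    (he : IsOrthonormalBasis M.g e) {s : ℝ} (hs : s * s = 1) {x : GenTangent 𝔤}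
    (hx : M.gen x = s • x) :
    x = s • ∑ i, genForm 𝔤 x (frameVec e s i) • frameVec e s i := by
  have hs0 : s ≠ 0 := by rintro rfl; simp at hs
  have h : ∀ i, genForm 𝔤 x (frameVec e (-s) i) = 0 := fun i =>
    M.genForm_eq_zero_of_gen hs0 hx (M.gen_frameVec he (by linarith) i)
  conv_lhs => rw [frameVec_expansion e hs x]
  simp [h]

variable {M : GenMetric 𝔤} {D : GenTangent 𝔤 →ₗ[ℝ] GenTangent 𝔤 →ₗ[ℝ] GenTangent 𝔤}

theorem IsLeviCivita.genForm_skew (hD : M.IsLeviCivita D) (a b c : GenTangent 𝔤) :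
    genForm 𝔤 b (D a c) = -genForm 𝔤 (D a b) c := by
  have h := hD.pairing a b c
  rw [genPairing_eq_genForm, genPairing_eq_genForm] at h
  linarith

theorem IsLeviCivita.gen_apply (hD : M.IsLeviCivita D) {s : ℝ} (a : GenTangent 𝔤)
    {b : GenTangent 𝔤} (hb : M.gen b = s • b) : M.gen (D a b) = s • D a b := by
  have h := LinearMap.congr_fun (hD.metric a) b
  simp only [LinearMap.comp_apply, hb, map_smul] at h
  exact h.symm

/-- In the torsion identity the other two terms pair `E_+` with `E_-`, because `D` preserves both
eigenspaces; they vanish by orthogonality. So the mixed part of `D` is forced. -/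
theorem IsLeviCivita.genForm_mixed (hD : M.IsLeviCivita D) {s : ℝ} (hs : s ≠ 0)
    {a b c : GenTangent 𝔤} (ha : M.gen a = (-s) • a) (hb : M.gen b = s • b)
    (hc : M.gen c = s • c) : genForm 𝔤 (D a b) c = M.dorfmanForm a b c := by
  have h := hD.torsion a b c
  have h1 : genForm 𝔤 (D b a) c = 0 := by
    rw [genForm_comm]; exact M.genForm_eq_zero_of_gen hs hc (hD.gen_apply b ha)
  have h2 : genForm 𝔤 b (D c a) = 0 := M.genForm_eq_zero_of_gen hs hb (hD.gen_apply c ha)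
  rw [genPairing_eq_genForm, genPairing_eq_genForm, sub_eq_add_neg, sub_eq_add_neg, map_add,
    map_add, ← neg_one_smul ℝ (D b a), ← neg_one_smul ℝ (M.dorfman a b), map_smul, map_smul] at h
  simp only [LinearMap.add_apply, LinearMap.smul_apply, smul_eq_mul, h1, h2] at h
  rw [dorfmanForm_def]; linarith

variable {e : Module.Basis (Fin 4) ℝ 𝔤}

theorem IsLeviCivita.divergence_apply (hD : M.IsLeviCivita D) (he : IsOrthonormalBasis M.g e)
    {s : ℝ} (hs : s * s = 1) {x : GenTangent 𝔤} (hx : M.gen x = s • x) :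
    divergence D x = s * ∑ i, genForm 𝔤 (D (frameVec e s i) x) (frameVec e s i) := by
  have hs0 : s ≠ 0 := by rintro rfl; simp at hs
  have h : ∀ i, genForm 𝔤 (D (frameVec e (-s) i) x) (frameVec e (-s) i) = 0 := fun i =>
    M.genForm_eq_zero_of_gen hs0 (hD.gen_apply _ hx) (M.gen_frameVec he (by linarith) i)
  rw [divergence, LinearMap.comp_apply, trace_eq_sum_genForm e hs]
  simp [h]

theorem proj_apply_coe (M : GenMetric 𝔤) (σ : ℤˣ) (x : GenTangent 𝔤) :
    (M.proj σ x : GenTangent 𝔤) = (1 / 2 : ℝ) • (x + ((σ : ℤ) : ℝ) • M.gen x) := rfl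

theorem units_sq (σ : ℤˣ) : ((σ : ℤ) : ℝ) * ((σ : ℤ) : ℝ) = 1 := by
  rcases Int.units_eq_one_or σ with rfl | rfl <;> simp

/-- By cyclicity this is the trace on all of `E` of `T` composed with the projection, and the
projection kills the opposite frame. -/
theorem trace_proj_comp (he : IsOrthonormalBasis M.g e) (σ : ℤˣ)
    (T : GenTangent 𝔤 →ₗ[ℝ] GenTangent 𝔤) :
    LinearMap.trace ℝ (M.eigen σ) (M.proj σ ∘ₗ T ∘ₗ (M.eigen σ).subtype) =
      ((σ : ℤ) : ℝ) * ∑ i, genForm 𝔤 (T (frameVec e ((σ : ℤ) : ℝ) i))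
        (frameVec e ((σ : ℤ) : ℝ) i) := by
  have hs := units_sq σ
  set s : ℝ := ((σ : ℤ) : ℝ) with hsd
  have : Module.Free ℝ (M.eigen σ) := Module.Free.of_divisionRing ℝ (M.eigen σ)
  refine (LinearMap.trace_comp_comm' (M := M.eigen σ) (N := GenTangent 𝔤)
    (T ∘ₗ (M.eigen σ).subtype) (M.proj σ)).trans ?_
  rw [trace_eq_sum_genForm e hs]
  have h1 : ∀ i, (M.proj σ (frameVec e s i) : GenTangent 𝔤) = frameVec e s i := by
    intro i
    rw [proj_apply_coe, ← hsd, M.gen_frameVec he hs, smul_smul, hs, one_smul, ← two_smul ℝ,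
      smul_smul]
    norm_num
  have h2 : ∀ i, (M.proj σ (frameVec e (-s) i) : GenTangent 𝔤) = 0 := by
    intro i
    rw [proj_apply_coe, ← hsd, M.gen_frameVec he (by linarith), smul_smul, mul_neg, hs]
    rw [show frameVec e (-s) i + (-1 : ℝ) • frameVec e (-s) i
      = (1 + -1 : ℝ) • frameVec e (-s) i by rw [add_smul, one_smul], add_neg_cancel, zero_smul,
      smul_zero]
  simp [h1, h2]

theorem IsLeviCivita.apply_mixed (hD : M.IsLeviCivita D) (he : IsOrthonormalBasis M.g e) {s : ℝ}
    (hs : s * s = 1) {a b : GenTangent 𝔤} (ha : M.gen a = (-s) • a) (hb : M.gen b = s • b) :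
    D a b = s • ∑ i, M.dorfmanForm a b (frameVec e s i) • frameVec e s i := by
  have hs0 : s ≠ 0 := by rintro rfl; simp at hs
  conv_lhs => rw [M.expansion_of_gen he hs (hD.gen_apply a hb)]
  simp only [hD.genForm_mixed hs0 ha hb (M.gen_frameVec he hs _)]

/-- The generalised Ricci curvature in an orthonormal frame. -/
theorem IsLeviCivita.ricci_eq (hD : M.IsLeviCivita D) (he : IsOrthonormalBasis M.g e)
    (σ : ℤˣ) {s : ℝ} (hσ : ((σ : ℤ) : ℝ) = s) (u : M.eigen (-σ)) (c : M.eigen σ) :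
    M.ricci D σ u c =
      s * ∑ m, M.dorfmanForm u c (frameVec e s m) * divergence D (frameVec e s m)
      + ∑ k, ∑ m, M.dorfmanForm (frameVec e s k) u (frameVec e (-s) m)
        * M.dorfmanForm (frameVec e (-s) m) c (frameVec e s k) := by
  have hs : s * s = 1 := by rw [← hσ]; exact units_sq σ
  have hs' : (-s) * (-s) = 1 := by linarith
  have hs0 : s ≠ 0 := by rintro rfl; simp at hs
  have hu : M.gen u = (-s) • (u : GenTangent 𝔤) := by
    have := Module.End.mem_eigenspace_iff.1 u.2
    rwa [Units.val_neg, Int.cast_neg, hσ] at this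
  have hc : M.gen c = s • (c : GenTangent 𝔤) := by
    have := Module.End.mem_eigenspace_iff.1 c.2
    rwa [hσ] at this
  rw [ricci, trace_proj_comp he, hσ]
  generalize (u : GenTangent 𝔤) = u at hu ⊢
  generalize (c : GenTangent 𝔤) = c at hc ⊢
  have h1 : s * ∑ k, genForm 𝔤 (D (frameVec e s k) (D u c)) (frameVec e s k) =
      s * ∑ m, M.dorfmanForm u c (frameVec e s m) * divergence D (frameVec e s m) := by
    rw [← hD.divergence_apply he hs (hD.gen_apply u hc)]
    conv_lhs => rw [hD.apply_mixed he hs hu hc]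
    simp only [map_smul, map_sum, smul_eq_mul]
  have h2 : ∀ k, genForm 𝔤 (D u (D (frameVec e s k) c)) (frameVec e s k) =
      -(s * ∑ m, M.dorfmanForm u (frameVec e s k) (frameVec e s m)
        * genForm 𝔤 (D (frameVec e s k) c) (frameVec e s m)) := by
    intro k
    have h := hD.genForm_skew u (D (frameVec e s k) c) (frameVec e s k)
    rw [hD.apply_mixed he hs hu (M.gen_frameVec he hs k)] at h
    simp only [map_smul, map_sum, smul_eq_mul] at h
    linarith
  -- Splitting the bracket into its two eigencomponents separates a term with the undetermined
  -- pure-type part of `D` from a term quadratic in the bracket alone.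
  have h3 : ∀ k, genForm 𝔤 (D (M.dorfman (frameVec e s k) u) c) (frameVec e s k) =
      -(s * ∑ m, M.dorfmanForm u (frameVec e s k) (frameVec e s m)
        * genForm 𝔤 (D (frameVec e s m) c) (frameVec e s k))
      + -(s * ∑ m, M.dorfmanForm (frameVec e s k) u (frameVec e (-s) m)
        * M.dorfmanForm (frameVec e (-s) m) c (frameVec e s k)) := by
    intro k
    conv_lhs => rw [frameVec_expansion e hs (M.dorfman (frameVec e s k) u)]
    simp only [map_add, map_smul, map_sum, LinearMap.add_apply, LinearMap.smul_apply,
      LinearMap.sum_apply, smul_eq_mul, ← dorfmanForm_def,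
      hD.genForm_mixed hs0 (M.gen_frameVec he hs' _) hc (M.gen_frameVec he hs k),
      M.dorfmanForm_swap_left u (frameVec e s k) (frameVec e s _), neg_mul,
      Finset.sum_neg_distrib, mul_neg]
  have h4 : ∀ k, genForm 𝔤 (M.curvature D u c (frameVec e s k)) (frameVec e s k) =
      genForm 𝔤 (D (frameVec e s k) (D u c)) (frameVec e s k)
      + (-1) * genForm 𝔤 (D u (D (frameVec e s k) c)) (frameVec e s k)
      + (-1) * genForm 𝔤 (D (M.dorfman (frameVec e s k) u) c) (frameVec e s k) := by
    intro k
    change genForm 𝔤 (D (frameVec e s k) (D u c) - D u (D (frameVec e s k) c)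
      - D (M.dorfman (frameVec e s k) u) c) (frameVec e s k) = _
    rw [genForm_sub_left, genForm_sub_left]; ring
  simp only [h4, Finset.sum_add_distrib, mul_add, ← Finset.mul_sum]
  rw [h1]
  simp only [h2, h3, Finset.sum_add_distrib, Finset.sum_neg_distrib, ← Finset.mul_sum]
  rw [Finset.sum_comm (f := fun k m => M.dorfmanForm u (frameVec e s k) (frameVec e s m)
    * genForm 𝔤 (D (frameVec e s m) c) (frameVec e s k))]
  -- The pure-type contributions of `h2` and `h3` differ by exchanging the two frame indices, so by
  -- skew-symmetry of the bracket form they cancel.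
  have h5 : ∑ m, ∑ k, M.dorfmanForm u (frameVec e s k) (frameVec e s m)
      * genForm 𝔤 (D (frameVec e s m) c) (frameVec e s k) =
      -∑ m, ∑ k, M.dorfmanForm u (frameVec e s m) (frameVec e s k)
      * genForm 𝔤 (D (frameVec e s m) c) (frameVec e s k) := by
    simp only [← Finset.sum_neg_distrib, ← neg_mul]
    refine Finset.sum_congr rfl fun m _ => Finset.sum_congr rfl fun k _ => ?_
    rw [M.dorfmanForm_swap_right u (frameVec e s m)]
  rw [h5]
  linear_combination (∑ k, ∑ m, M.dorfmanForm (frameVec e s k) u (frameVec e (-s) m)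
        * M.dorfmanForm (frameVec e (-s) m) c (frameVec e s k)) * hs

end GenMetric

end

/-! ### Existence of connections with prescribed divergence, and the Einstein equation in a frame.
-/

noncomputable section

namespace GenMetric

variable {𝔤 : Type*} [LieRing 𝔤] [LieAlgebra ℝ 𝔤] [FiniteDimensional ℝ 𝔤]

/-- The projection of `E` onto the `s`-eigenspace of `𝒢_g`, for `s = ±1`, as an endomorphism. -/
def endProj (M : GenMetric 𝔤) (s : ℝ) : GenTangent 𝔤 →ₗ[ℝ] GenTangent 𝔤 :=
  (1 / 2 : ℝ) • (LinearMap.id + s • M.gen)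

theorem endProj_apply (M : GenMetric 𝔤) (s : ℝ) (x : GenTangent 𝔤) :
    M.endProj s x = (1 / 2 : ℝ) • x + (s / 2) • M.gen x := by
  simp only [endProj, LinearMap.smul_apply, LinearMap.add_apply, LinearMap.id_apply, smul_add,
    smul_smul]
  congr 2; ring

theorem endProj_add (M : GenMetric 𝔤) (x : GenTangent 𝔤) :
    M.endProj 1 x + M.endProj (-1) x = x := by
  rw [endProj_apply, endProj_apply, add_add_add_comm, ← add_smul, ← add_smul]
  norm_num

theorem gen_endProj (M : GenMetric 𝔤) {s : ℝ} (hs : s * s = 1) (x : GenTangent 𝔤) :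
    M.gen (M.endProj s x) = s • M.endProj s x := by
  rw [endProj_apply, map_add, map_smul, map_smul, gen_gen, smul_add, smul_smul, smul_smul, add_comm]
  congr 2
  · ring
  · linear_combination (-1 / 2) * hs

theorem endProj_gen (M : GenMetric 𝔤) {s : ℝ} (hs : s * s = 1) (x : GenTangent 𝔤) :
    M.endProj s (M.gen x) = s • M.endProj s x := by
  rw [endProj_apply, endProj_apply, gen_gen, smul_add, smul_smul, smul_smul, add_comm]
  congr 2
  · ring
  · linear_combination (-1 / 2) * hs

theorem endProj_of_gen (M : GenMetric 𝔤) {s : ℝ} (hs : s * s = 1) {x : GenTangent 𝔤}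
    (hx : M.gen x = s • x) : M.endProj s x = x := by
  rw [endProj_apply, hx, smul_smul, ← add_smul]
  rw [show (1 / 2 + s / 2 * s : ℝ) = 1 by linear_combination (1 / 2) * hs, one_smul]

theorem endProj_neg_of_gen (M : GenMetric 𝔤) {s : ℝ} (hs : s * s = 1) {x : GenTangent 𝔤}
    (hx : M.gen x = s • x) : M.endProj (-s) x = 0 := by
  rw [endProj_apply, hx, smul_smul, ← add_smul]
  rw [show (1 / 2 + -s / 2 * s : ℝ) = 0 by linear_combination (-1 / 2) * hs, zero_smul]

theorem genForm_endProj (M : GenMetric 𝔤) (s : ℝ) (x y : GenTangent 𝔤) :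
    genForm 𝔤 (M.endProj s x) y = genForm 𝔤 x (M.endProj s y) := by
  simp only [endProj_apply, map_add, map_smul, LinearMap.add_apply, LinearMap.smul_apply,
    genForm_gen]

/-- The part of a generalised Levi-Civita connection that differentiates sections of the
`s`-eigenspace, with the divergence prescribed by `v`. -/
def partialConnection (M : GenMetric 𝔤) (s : ℝ) (v : GenTangent 𝔤) :
    GenTangent 𝔤 →ₗ[ℝ] GenTangent 𝔤 →ₗ[ℝ] GenTangent 𝔤 :=
  LinearMap.mk₂ ℝ
    -- The first term is the forced mixed part. The factor 1/3 makes the cyclic sum of the pure part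
    -- equal to the bracket form. The last two terms give a tensor skew in its last two slots with
    -- zero cyclic sum, so they leave the torsion alone and only change the divergence.
    (fun a b => M.endProj s (M.dorfman (M.endProj (-s) a) (M.endProj s b))
      + (1 / 3 : ℝ) • M.endProj s (M.dorfman (M.endProj s a) (M.endProj s b))
      + genForm 𝔤 (M.endProj s a) b • M.endProj s v
      + (-genForm 𝔤 (M.endProj s v) b) • M.endProj s a)
    (by intro a a' b; simp only [map_add, LinearMap.add_apply, smul_add, add_smul]; abel)
    (by
      intro c a b
      simp only [map_smul, LinearMap.smul_apply, smul_add, smul_smul, smul_eq_mul, mul_comm])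
    (by intro a b b'; simp only [map_add, smul_add, neg_add, add_smul]; abel)
    (by
      intro c a b
      simp only [map_smul, smul_add, smul_smul, smul_eq_mul, mul_neg, mul_comm])

theorem genForm_partialConnection (M : GenMetric 𝔤) (s : ℝ) (v a b c : GenTangent 𝔤) :
    genForm 𝔤 (M.partialConnection s v a b) c =
      M.dorfmanForm (M.endProj (-s) a) (M.endProj s b) (M.endProj s c)
      + (1 / 3) * M.dorfmanForm (M.endProj s a) (M.endProj s b) (M.endProj s c)
      + genForm 𝔤 (M.endProj s a) b * genForm 𝔤 (M.endProj s v) c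
      - genForm 𝔤 (M.endProj s v) b * genForm 𝔤 (M.endProj s a) c := by
  simp only [partialConnection, LinearMap.mk₂_apply, map_add, map_smul, LinearMap.add_apply,
    LinearMap.smul_apply, smul_eq_mul, genForm_endProj M s (M.dorfman _ _), dorfmanForm_def]
  ring

theorem partialConnection_gen (M : GenMetric 𝔤) {s : ℝ} (hs : s * s = 1) (v a b : GenTangent 𝔤) :
    M.partialConnection s v a (M.gen b) = M.gen (M.partialConnection s v a b) := by
  simp only [partialConnection, LinearMap.mk₂_apply, map_add, map_smul, endProj_gen M hs,
    gen_endProj M hs, ← genForm_gen, smul_smul, smul_eq_mul, LinearMap.smul_apply,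
    mul_neg, mul_comm]

/-- A generalised Levi-Civita connection. -/
def leviCivita (M : GenMetric 𝔤) (v w : GenTangent 𝔤) :
    GenTangent 𝔤 →ₗ[ℝ] GenTangent 𝔤 →ₗ[ℝ] GenTangent 𝔤 :=
  M.partialConnection 1 v + M.partialConnection (-1) w

/-- Given compatibility with the pairing, vanishing torsion says that the cyclic sum of `⟨D_a b, c⟩`
is the bracket form of `a, b, c`. This is checked on each combination of eigencomponents. -/
theorem isLeviCivita_leviCivita (M : GenMetric 𝔤) (v w : GenTangent 𝔤) :
    M.IsLeviCivita (M.leviCivita v w) := by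
  have key : ∀ a b c, genForm 𝔤 (M.leviCivita v w a b) c =
      genForm 𝔤 (M.partialConnection 1 v a b) c + genForm 𝔤 (M.partialConnection (-1) w a b) c := by
    intro a b c
    simp only [leviCivita, LinearMap.add_apply, map_add]
  have sr := M.dorfmanForm_swap_right
  have skew : ∀ a b c, genForm 𝔤 (M.leviCivita v w a b) c + genForm 𝔤 b (M.leviCivita v w a c)
      = 0 := by
    intro a b c
    rw [genForm_comm b, key, key]
    simp only [genForm_partialConnection, neg_neg]
    have e1 := sr (M.endProj (-1) a) (M.endProj 1 b) (M.endProj 1 c)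
    have e2 := sr (M.endProj 1 a) (M.endProj 1 b) (M.endProj 1 c)
    have e3 := sr (M.endProj 1 a) (M.endProj (-1) b) (M.endProj (-1) c)
    have e4 := sr (M.endProj (-1) a) (M.endProj (-1) b) (M.endProj (-1) c)
    rw [e1, e2, e3, e4]; ring
  refine ⟨skew, ?_, ?_⟩
  · intro a b c
    rw [genPairing_eq_genForm, genPairing_eq_genForm, genForm_sub_left, genForm_sub_left,
      ← dorfmanForm_def]
    have h1 : genForm 𝔤 (M.leviCivita v w b a) c = -genForm 𝔤 (M.leviCivita v w b c) a := by
      have := skew b a c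
      rw [genForm_comm a] at this; linarith
    rw [h1, genForm_comm b, key, key, key]
    have h2 : M.dorfmanForm a b c = M.dorfmanForm (M.endProj 1 a + M.endProj (-1) a)
      (M.endProj 1 b + M.endProj (-1) b) (M.endProj 1 c + M.endProj (-1) c) := by
      simp only [endProj_add]
    rw [h2]
    simp only [map_add, LinearMap.add_apply, genForm_partialConnection, neg_neg]
    have cyc := M.dorfmanForm_cycle
    rw [cyc (M.endProj 1 a) (M.endProj 1 b) (M.endProj 1 c),
      cyc (M.endProj (-1) a) (M.endProj (-1) b) (M.endProj (-1) c),
      cyc (M.endProj 1 a) (M.endProj (-1) b) (M.endProj 1 c),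
      cyc (M.endProj (-1) a) (M.endProj 1 b) (M.endProj (-1) c),
      ← cyc (M.endProj (-1) c) (M.endProj 1 a) (M.endProj 1 b),
      ← cyc (M.endProj 1 c) (M.endProj (-1) a) (M.endProj (-1) b),
      ← cyc (M.endProj 1 c) (M.endProj 1 a) (M.endProj 1 b),
      ← cyc (M.endProj (-1) c) (M.endProj (-1) a) (M.endProj (-1) b)]
    have sy : ∀ s x y, genForm 𝔤 (M.endProj s x) y = genForm 𝔤 (M.endProj s y) x := by
      intro s x y; rw [genForm_endProj, genForm_comm]
    rw [sy 1 b a, sy 1 c a, sy 1 c b, sy (-1) b a, sy (-1) c a, sy (-1) c b]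
    ring
  · intro a
    refine LinearMap.ext fun b => ?_
    simp only [LinearMap.comp_apply, leviCivita, LinearMap.add_apply, map_add,
      partialConnection_gen M (show (1 : ℝ) * 1 = 1 by norm_num),
      partialConnection_gen M (show (-1 : ℝ) * -1 = 1 by norm_num)]

variable {M : GenMetric 𝔤} {e : Module.Basis (Fin 4) ℝ 𝔤}

omit [FiniteDimensional ℝ 𝔤] in
theorem dual_ext_frameVec {φ ψ : Module.Dual ℝ (GenTangent 𝔤)}
    (h : ∀ i, φ (frameVec e 1 i) = ψ (frameVec e 1 i))
    (h' : ∀ i, φ (frameVec e (-1) i) = ψ (frameVec e (-1) i)) : φ = ψ := by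
  refine LinearMap.ext fun x => ?_
  rw [frameVec_expansion e (show (1 : ℝ) * 1 = 1 by norm_num) x]
  simp only [map_add, map_smul, map_sum, h, h']

/-- The bracket terms drop out by skew-symmetry. The tensor built from `v` contributes `1 - 4 = -3`
copies of `s⟨v, ·⟩`, the 4 being the rank of the eigenspace. -/
theorem sum_genForm_partialConnection (he : IsOrthonormalBasis M.g e) {s : ℝ} (hs : s * s = 1)
    (v : GenTangent 𝔤) (hv : M.gen v = s • v) (j : Fin 4) :
    ∑ i, genForm 𝔤 (M.partialConnection s v (frameVec e s i) (frameVec e s j)) (frameVec e s i) =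
      -3 * s * genForm 𝔤 v (frameVec e s j) := by
  have h1 : ∀ i, M.endProj s (frameVec e s i) = frameVec e s i := fun i =>
    M.endProj_of_gen hs (M.gen_frameVec he hs i)
  have h2 : ∀ i, M.endProj (-s) (frameVec e s i) = 0 := fun i =>
    M.endProj_neg_of_gen hs (M.gen_frameVec he hs i)
  have h3 : ∀ i, M.dorfmanForm (frameVec e s i) (frameVec e s j) (frameVec e s i) = 0 := by
    intro i
    have a := M.dorfmanForm_cycle (frameVec e s i) (frameVec e s i) (frameVec e s j)
    have b := M.dorfmanForm_swap_left (frameVec e s i) (frameVec e s i) (frameVec e s j)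
    linarith
  simp only [genForm_partialConnection, h1, h2, map_zero, LinearMap.zero_apply, h3,
    M.endProj_of_gen hs hv, genForm_frameVec_frameVec, if_true, Finset.sum_sub_distrib,
    Finset.sum_add_distrib, ite_mul, zero_mul, Finset.sum_ite_eq', Finset.sum_const,
    Finset.mem_univ, Finset.card_univ, Fintype.card_fin]
  simp
  ring

theorem partialConnection_frameVec_neg (he : IsOrthonormalBasis M.g e) {s : ℝ} (hs : s * s = 1)
    (v a : GenTangent 𝔤) (hv : M.gen v = s • v) (j : Fin 4) :
    M.partialConnection s v a (frameVec e (-s) j) = 0 := by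
  have hs' : -s * -s = 1 := by linarith
  have hs0 : s ≠ 0 := by rintro rfl; simp at hs
  have h2 : M.endProj s (frameVec e (-s) j) = 0 := by
    have := M.endProj_neg_of_gen hs' (M.gen_frameVec he hs' j)
    rwa [neg_neg] at this
  have h3 := M.genForm_eq_zero_of_gen hs0 hv (M.gen_frameVec he hs' j)
  have h4 := M.genForm_eq_zero_of_gen hs0 (M.gen_endProj hs a) (M.gen_frameVec he hs' j)
  simp [partialConnection, h2, h3, h4, M.endProj_of_gen hs hv]

theorem exists_leviCivita_divergence (he : IsOrthonormalBasis M.g e)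
    (δ : Module.Dual ℝ (GenTangent 𝔤)) : ∃ D, M.IsLeviCivita D ∧ divergence D = δ := by
  -- The 1/3 compensates the factor 3 in `sum_genForm_partialConnection`; the `s` compensates the
  -- square norm `s` of the frame vectors.
  let v : ℝ → GenTangent 𝔤 := fun s =>
    ∑ m, (-(s / 3) * δ (frameVec e s m)) • frameVec e s m
  have hv : ∀ {s : ℝ}, s * s = 1 → M.gen (v s) = s • v s := by
    intro s hs
    simp only [v, map_sum, map_smul, Finset.smul_sum, M.gen_frameVec he hs, smul_smul, mul_comm]
  have hv' : ∀ {s : ℝ}, s * s = 1 → ∀ j, genForm 𝔤 (v s) (frameVec e s j) =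
      -(1 / 3) * δ (frameVec e s j) := by
    intro s hs j
    simp only [v, map_sum, map_smul, LinearMap.sum_apply, LinearMap.smul_apply,
      genForm_frameVec_frameVec, smul_eq_mul, mul_ite, mul_zero, Finset.sum_ite_eq',
      Finset.mem_univ, if_true]
    linear_combination (-1 / 3) * δ (frameVec e s j) * hs
  have o1 : (1 : ℝ) * 1 = 1 := by norm_num
  have o2 : (-1 : ℝ) * -1 = 1 := by norm_num
  have hD := M.isLeviCivita_leviCivita (v 1) (v (-1))
  refine ⟨_, hD, dual_ext_frameVec (e := e) (fun j => ?_) fun j => ?_⟩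
  · rw [hD.divergence_apply he o1 (M.gen_frameVec he o1 j)]
    have h0 : ∀ a, M.partialConnection (-1) (v (-1)) a (frameVec e 1 j) = 0 := fun a => by
      have := partialConnection_frameVec_neg he o2 (v (-1)) a (hv o2) j
      rwa [neg_neg] at this
    simp only [leviCivita, LinearMap.add_apply, h0, add_zero,
      sum_genForm_partialConnection he o1 _ (hv o1), hv' o1]
    ring
  · rw [hD.divergence_apply he o2 (M.gen_frameVec he o2 j)]
    have h0 : ∀ a, M.partialConnection 1 (v 1) a (frameVec e (-1) j) = 0 := fun a =>
      partialConnection_frameVec_neg he o1 (v 1) a (hv o1) j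
    simp only [leviCivita, LinearMap.add_apply, h0, zero_add,
      sum_genForm_partialConnection he o2 _ (hv o2), hv' o2]
    ring

/-- The generalised Einstein equation in an orthonormal frame. -/
theorem isGenEinstein_iff (he : IsOrthonormalBasis M.g e) (δ : Module.Dual ℝ (GenTangent 𝔤)) :
    M.IsGenEinstein δ ↔ ∀ s : ℝ, s * s = 1 → ∀ i j,
      s * ∑ m, M.dorfmanForm (frameVec e (-s) i) (frameVec e s j) (frameVec e s m)
        * δ (frameVec e s m)
      + ∑ k, ∑ m, M.dorfmanForm (frameVec e s k) (frameVec e (-s) i) (frameVec e (-s) m)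
        * M.dorfmanForm (frameVec e (-s) m) (frameVec e s j) (frameVec e s k) = 0 := by
  constructor
  · rintro ⟨⟨D, hD, rfl⟩, h⟩ s hs i j
    obtain ⟨σ, hσ⟩ : ∃ σ : ℤˣ, ((σ : ℤ) : ℝ) = s := by
      rcases mul_self_eq_one_iff.1 hs with rfl | rfl
      · exact ⟨1, by simp⟩
      · exact ⟨-1, by simp⟩
    have hu : frameVec e (-s) i ∈ M.eigen (-σ) := by
      rw [Module.End.mem_eigenspace_iff, Units.val_neg, Int.cast_neg, hσ]
      exact M.gen_frameVec he (by linarith) i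
    have hc : frameVec e s j ∈ M.eigen σ := by
      rw [Module.End.mem_eigenspace_iff, hσ]
      exact M.gen_frameVec he hs j
    have := h D hD rfl σ ⟨_, hu⟩ ⟨_, hc⟩
    rwa [hD.ricci_eq he σ hσ] at this
  · intro h
    refine ⟨exists_leviCivita_divergence he δ, ?_⟩
    rintro D hD rfl σ u c
    rw [hD.ricci_eq he σ rfl]
    have hs := units_sq σ
    have hu := Module.End.mem_eigenspace_iff.1 u.2
    rw [Units.val_neg, Int.cast_neg] at hu
    have hc := Module.End.mem_eigenspace_iff.1 c.2
    generalize ((σ : ℤ) : ℝ) = s at hs hu hc ⊢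
    have hs' : -s * -s = 1 := by linarith
    -- The frame expression for the Ricci curvature is bilinear in `u` and `c`, so its vanishing on
    -- frame vectors suffices.
    let F : GenTangent 𝔤 →ₗ[ℝ] GenTangent 𝔤 →ₗ[ℝ] ℝ := LinearMap.mk₂ ℝ
      (fun u c => s * ∑ m, M.dorfmanForm u c (frameVec e s m) * divergence D (frameVec e s m)
      + ∑ k, ∑ m, M.dorfmanForm (frameVec e s k) u (frameVec e (-s) m)
        * M.dorfmanForm (frameVec e (-s) m) c (frameVec e s k))
      (by
        intro x y z
        simp only [map_add, LinearMap.add_apply, add_mul, Finset.sum_add_distrib, mul_add]; ring)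
      (by
        intro x y z
        simp only [map_smul, LinearMap.smul_apply, smul_eq_mul, Finset.mul_sum, mul_add, mul_assoc,
          mul_left_comm])
      (by
        intro x y z
        simp only [map_add, LinearMap.add_apply, add_mul, Finset.sum_add_distrib, mul_add]; ring)
      (by
        intro x y z
        simp only [map_smul, LinearMap.smul_apply, smul_eq_mul, Finset.mul_sum, mul_add, mul_assoc,
          mul_left_comm])
    change F u c = 0
    have hF : ∀ i j, F (frameVec e (-s) i) (frameVec e s j) = 0 := fun i j => h s hs i j
    rw [M.expansion_of_gen he hs' hu, M.expansion_of_gen he hs hc]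
    simp only [map_smul, map_sum, LinearMap.smul_apply, LinearMap.sum_apply, hF, smul_zero,
      Finset.sum_const_zero]

end GenMetric

end

/-! ### The divergence-free part of the Ricci curvature vanishes. -/

noncomputable section

theorem sum_skew_mul_symm {ι : Type*} [Fintype ι] (n S : ι → ι → ℝ)
    (hn : ∀ j p, n j p = -n p j) (hS : ∀ j p, S j p = S p j) : ∑ j, ∑ p, n j p * S j p = 0 := by
  have h : ∑ j, ∑ p, n j p * S j p = -∑ j, ∑ p, n j p * S j p := by
    conv_lhs => rw [Finset.sum_comm]
    simp only [← Finset.sum_neg_distrib]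
    refine Finset.sum_congr rfl fun j _ => Finset.sum_congr rfl fun p _ => ?_
    rw [hn p j, hS p j]; ring
  linarith

theorem sum_cycle {ι : Type*} [Fintype ι] (f : ι → ι → ι → ℝ) :
    ∑ j, ∑ k, ∑ l, f k l j = ∑ j, ∑ k, ∑ l, f j k l := by
  rw [Finset.sum_comm]
  refine Finset.sum_congr rfl fun j _ => ?_
  rw [Finset.sum_comm]

theorem sum_reverse {ι : Type*} [Fintype ι] (f : ι → ι → ι → ℝ) :
    ∑ j, ∑ k, ∑ l, f l k j = ∑ j, ∑ k, ∑ l, f j k l := by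
  rw [← sum_cycle]
  refine Finset.sum_congr rfl fun j _ => ?_
  rw [Finset.sum_comm]

namespace GenMetric

variable {𝔤 : Type*} [LieRing 𝔤] [LieAlgebra ℝ 𝔤]

theorem dorfman_expansion (M : GenMetric 𝔤) (e : Module.Basis (Fin 4) ℝ 𝔤) (x y : GenTangent 𝔤) :
    M.dorfman x y = ∑ p, M.dorfmanForm x y (frameVec e 1 p) • frameVec e 1 p
      + (-1 : ℝ) • ∑ p, M.dorfmanForm x y (frameVec e (-1) p) • frameVec e (-1) p := by
  conv_lhs => rw [frameVec_expansion e (show (1 : ℝ) * 1 = 1 by norm_num) (M.dorfman x y)]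
  rw [one_smul]; rfl

theorem dorfmanForm_dorfman (M : GenMetric 𝔤) (e : Module.Basis (Fin 4) ℝ 𝔤)
    (x y z w : GenTangent 𝔤) :
    M.dorfmanForm (M.dorfman x y) z w =
      ∑ p, M.dorfmanForm x y (frameVec e 1 p) * M.dorfmanForm (frameVec e 1 p) z w
      - ∑ p, M.dorfmanForm x y (frameVec e (-1) p) * M.dorfmanForm (frameVec e (-1) p) z w := by
  conv_lhs => rw [M.dorfman_expansion e x y]
  simp only [map_add, map_smul, map_sum, LinearMap.add_apply, LinearMap.smul_apply,
    LinearMap.sum_apply, smul_eq_mul]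
  ring

/-- The Ricci tensor in an orthonormal frame of the Levi-Civita connections without divergence. -/
def frameRicci (M : GenMetric 𝔤) (e : Module.Basis (Fin 4) ℝ 𝔤) (i j : Fin 4) : ℝ :=
  ∑ k, ∑ m, M.dorfmanForm (frameVec e 1 k) (frameVec e (-1) i) (frameVec e (-1) m)
    * M.dorfmanForm (frameVec e (-1) m) (frameVec e 1 j) (frameVec e 1 k)

/-- Invariance of the bracket form `F` under `ad x`, evaluated on `(a_j, a_k, a_l)`, is contracted
with `F(a_j, a_k, a_l)`. The three terms are cyclic images of one another, so each sum is zero. In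
`[x, a_j]` the `E_+` component contributes a skew matrix against a symmetric one, hence nothing, and
the `E_-` component is the claim. -/
theorem sum_mixed_contraction (M : GenMetric 𝔤) (e : Module.Basis (Fin 4) ℝ 𝔤)
    (x : GenTangent 𝔤) :
    ∑ j, ∑ k, ∑ l, M.dorfmanForm (frameVec e 1 j) (frameVec e 1 k) (frameVec e 1 l)
      * ∑ p, M.dorfmanForm x (frameVec e 1 j) (frameVec e (-1) p)
        * M.dorfmanForm (frameVec e (-1) p) (frameVec e 1 k) (frameVec e 1 l) = 0 := by
  set a := frameVec e 1
  set u := frameVec e (-1)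
  have cyc := M.dorfmanForm_cycle
  have inv : ∀ j k l, M.dorfmanForm (M.dorfman x (a j)) (a k) (a l)
      + M.dorfmanForm (M.dorfman x (a k)) (a l) (a j)
      + M.dorfmanForm (M.dorfman x (a l)) (a j) (a k) = 0 := by
    intro j k l
    have h := M.dorfmanForm_invariant x (a j) (a k) (a l)
    rw [← cyc (a j) (M.dorfman x (a k)) (a l),
      cyc (M.dorfman x (a l)) (a j) (a k)] at h
    exact h
  have h1 : ∑ j, ∑ k, ∑ l, M.dorfmanForm (a j) (a k) (a l)
      * M.dorfmanForm (M.dorfman x (a j)) (a k) (a l) = 0 := by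
    set f : Fin 4 → Fin 4 → Fin 4 → ℝ := fun j k l => M.dorfmanForm (a j) (a k) (a l)
      * M.dorfmanForm (M.dorfman x (a j)) (a k) (a l) with hf
    have h2 : ∑ j, ∑ k, ∑ l, (f j k l + f k l j + f l j k) = 0 := by
      refine Finset.sum_eq_zero fun j _ => Finset.sum_eq_zero fun k _ =>
        Finset.sum_eq_zero fun l _ => ?_
      simp only [hf]
      rw [cyc (a j) (a k) (a l), ← cyc (a l) (a j) (a k), ← mul_add, ← mul_add, inv, mul_zero]
    simp only [Finset.sum_add_distrib] at h2
    have h3 := sum_cycle f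
    have h4 := sum_cycle fun j k l => f k l j
    change ∑ j, ∑ k, ∑ l, f j k l = 0
    linarith
  simp only [M.dorfmanForm_dorfman e, mul_sub, Finset.sum_sub_distrib] at h1
  have h5 : ∑ j, ∑ k, ∑ l, M.dorfmanForm (a j) (a k) (a l)
      * ∑ p, M.dorfmanForm x (a j) (a p) * M.dorfmanForm (a p) (a k) (a l) = 0 := by
    rw [← sum_skew_mul_symm (fun j p => M.dorfmanForm x (a j) (a p))
      (fun j p => ∑ k, ∑ l, M.dorfmanForm (a j) (a k) (a l) * M.dorfmanForm (a p) (a k) (a l))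
      (fun j p => M.dorfmanForm_swap_right _ _ _) (fun j p => by simp only [mul_comm])]
    refine Finset.sum_congr rfl fun j _ => ?_
    simp only [Finset.mul_sum]
    rw [← sum_cycle]
    refine Finset.sum_congr rfl fun k _ => Finset.sum_congr rfl fun l _ =>
      Finset.sum_congr rfl fun p _ => by ring
  rw [h5] at h1
  linarith

/-- The Ricci tensor is orthogonal to the change of the generalised metric under the inner
derivation `ad x`. The proof contracts invariance of the bracket form `F` on `(u_l, a_j, a_k)` with
`F(u_l, a_j, a_k)`. The term with `[x, u_l]` vanishes by `sum_mixed_contraction`, the other two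
agree by skew-symmetry, and the `E_-` component of `[x, a_j]` produces the Ricci contraction. -/
theorem sum_dorfmanForm_mul_frameRicci (M : GenMetric 𝔤) (e : Module.Basis (Fin 4) ℝ 𝔤)
    (x : GenTangent 𝔤) :
    ∑ i, ∑ j, M.dorfmanForm (frameVec e (-1) i) (frameVec e 1 j) x * M.frameRicci e i j = 0 := by
  have h0 := M.sum_mixed_contraction e x
  simp only [frameRicci]
  set a := frameVec e 1
  set u := frameVec e (-1)
  have cyc := M.dorfmanForm_cycle
  have swr := M.dorfmanForm_swap_right
  have swl := M.dorfmanForm_swap_left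
  have inv : ∑ l, ∑ j, ∑ k, M.dorfmanForm (u l) (a j) (a k)
      * (M.dorfmanForm (M.dorfman x (u l)) (a j) (a k)
        - M.dorfmanForm (M.dorfman x (a j)) (u l) (a k)
        + M.dorfmanForm (M.dorfman x (a k)) (u l) (a j)) = 0 := by
    refine Finset.sum_eq_zero fun l _ => Finset.sum_eq_zero fun j _ =>
        Finset.sum_eq_zero fun k _ => ?_
    have h := M.dorfmanForm_invariant x (u l) (a j) (a k)
    rw [swl (M.dorfman x (a j)) (u l), cyc (M.dorfman x (a k)) (u l) (a j)] at h
    rw [sub_eq_add_neg, h, mul_zero]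
  simp only [mul_sub, mul_add, Finset.sum_sub_distrib, Finset.sum_add_distrib] at inv
  have e1 : ∑ l, ∑ j, ∑ k, M.dorfmanForm (u l) (a j) (a k)
      * M.dorfmanForm (M.dorfman x (u l)) (a j) (a k) = 0 := by
    simp only [M.dorfmanForm_dorfman e, mul_sub, Finset.sum_sub_distrib]
    have p1 : ∑ l, ∑ j, ∑ k, M.dorfmanForm (u l) (a j) (a k)
        * ∑ p, M.dorfmanForm x (u l) (a p) * M.dorfmanForm (a p) (a j) (a k) =
        -∑ j, ∑ k, ∑ l, M.dorfmanForm (a j) (a k) (a l)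
          * ∑ p, M.dorfmanForm x (a j) (u p) * M.dorfmanForm (u p) (a k) (a l) := by
      simp only [Finset.mul_sum, ← Finset.sum_neg_distrib]
      trans ∑ l, ∑ p, ∑ j, ∑ k, M.dorfmanForm x (u l) (a p)
        * M.dorfmanForm (u l) (a j) (a k) * M.dorfmanForm (a p) (a j) (a k)
      · refine Finset.sum_congr rfl fun l _ => ?_
        rw [← sum_cycle]
        refine Finset.sum_congr rfl fun k _ => Finset.sum_congr rfl fun l _ =>
          Finset.sum_congr rfl fun p _ => by ring
      · rw [Finset.sum_comm]
        refine Finset.sum_congr rfl fun l _ => ?_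
        rw [← sum_cycle, ← sum_cycle]
        refine Finset.sum_congr rfl fun k _ => Finset.sum_congr rfl fun m _ =>
          Finset.sum_congr rfl fun p _ => ?_
        rw [swr x (a l)]; ring
    have p2 : ∑ l, ∑ j, ∑ k, M.dorfmanForm (u l) (a j) (a k)
        * ∑ p, M.dorfmanForm x (u l) (u p) * M.dorfmanForm (u p) (a j) (a k) = 0 := by
      rw [← sum_skew_mul_symm (fun j p => M.dorfmanForm x (u j) (u p))
        (fun j p => ∑ k, ∑ l, M.dorfmanForm (u j) (a k) (a l) * M.dorfmanForm (u p) (a k) (a l))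
        (fun j p => M.dorfmanForm_swap_right _ _ _) (fun j p => by simp only [mul_comm])]
      refine Finset.sum_congr rfl fun j _ => ?_
      simp only [Finset.mul_sum]
      rw [← sum_cycle]
      refine Finset.sum_congr rfl fun k _ => Finset.sum_congr rfl fun l _ =>
        Finset.sum_congr rfl fun p _ => by ring
    rw [p1, p2, h0]; ring
  have e2 : ∑ l, ∑ j, ∑ k, M.dorfmanForm (u l) (a j) (a k)
        * M.dorfmanForm (M.dorfman x (a k)) (u l) (a j) =
      -∑ l, ∑ j, ∑ k, M.dorfmanForm (u l) (a j) (a k)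
        * M.dorfmanForm (M.dorfman x (a j)) (u l) (a k) := by
    simp only [← Finset.sum_neg_distrib]
    refine Finset.sum_congr rfl fun l _ => ?_
    rw [Finset.sum_comm]
    refine Finset.sum_congr rfl fun j _ => Finset.sum_congr rfl fun k _ => ?_
    rw [swr (u l) (a j)]; ring
  have e3 : ∑ l, ∑ j, ∑ k, M.dorfmanForm (u l) (a j) (a k)
        * M.dorfmanForm (M.dorfman x (a j)) (u l) (a k) = 0 := by linarith
  simp only [M.dorfmanForm_dorfman e, mul_sub, Finset.sum_sub_distrib] at e3
  have q1 : ∑ l, ∑ j, ∑ k, M.dorfmanForm (u l) (a j) (a k)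
      * ∑ p, M.dorfmanForm x (a j) (a p) * M.dorfmanForm (a p) (u l) (a k) = 0 := by
    refine Finset.sum_eq_zero fun l _ => ?_
    rw [← sum_skew_mul_symm (fun j p => M.dorfmanForm x (a j) (a p))
      (fun j p => ∑ k, -M.dorfmanForm (u l) (a j) (a k) * M.dorfmanForm (u l) (a p) (a k))
      (fun j p => M.dorfmanForm_swap_right _ _ _)
      (fun j p => Finset.sum_congr rfl fun k _ => by ring)]
    refine Finset.sum_congr rfl fun j _ => ?_
    simp only [Finset.mul_sum]
    rw [Finset.sum_comm]
    refine Finset.sum_congr rfl fun k _ => Finset.sum_congr rfl fun m _ => ?_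
    rw [swl (u l) (a k)]; ring
  rw [q1, zero_sub, neg_eq_zero] at e3
  rw [← neg_eq_zero, ← e3, Finset.sum_comm, Finset.sum_comm (γ := Fin 4) (f := fun l j =>
    ∑ k, M.dorfmanForm (u l) (a j) (a k)
      * ∑ p, M.dorfmanForm x (a j) (u p) * M.dorfmanForm (u p) (u l) (a k))]
  simp only [Finset.mul_sum, ← Finset.sum_neg_distrib]
  refine Finset.sum_congr rfl fun j _ => ?_
  rw [← sum_reverse]
  refine Finset.sum_congr rfl fun k _ => Finset.sum_congr rfl fun l _ =>
    Finset.sum_congr rfl fun p _ => ?_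
  rw [cyc x (u p) (a j), swr x (a j) (u p), cyc (a l) (u p) (u k)]
  ring

variable [FiniteDimensional ℝ 𝔤] {M : GenMetric 𝔤} {e : Module.Basis (Fin 4) ℝ 𝔤}

/-- With `x` the vector of `E_+` representing the restriction of `δ`, the Einstein equation turns
the orthogonality relation into the vanishing of the sum of squares of the Ricci components. -/
theorem IsGenEinstein.frameRicci_eq_zero (he : IsOrthonormalBasis M.g e)
    {δ : Module.Dual ℝ (GenTangent 𝔤)} (h : M.IsGenEinstein δ) (i j : Fin 4) :
    M.frameRicci e i j = 0 := by
  have h1 := (isGenEinstein_iff he δ).1 h 1 (by norm_num)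
  set x : GenTangent 𝔤 := ∑ m, δ (frameVec e 1 m) • frameVec e 1 m with hx
  have h2 : ∀ i j, M.dorfmanForm (frameVec e (-1) i) (frameVec e 1 j) x = -M.frameRicci e i j := by
    intro i j
    have := h1 i j
    simp only [hx, map_sum, map_smul, smul_eq_mul, frameRicci]
    simp only [mul_comm] at this ⊢
    linarith
  have h3 := M.sum_dorfmanForm_mul_frameRicci e x
  simp only [h2, neg_mul, Finset.sum_neg_distrib, neg_eq_zero] at h3
  have h4 := (Finset.sum_eq_zero_iff_of_nonneg
    (fun i _ => Finset.sum_nonneg fun j _ => mul_self_nonneg _)).1 h3 i (Finset.mem_univ _)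
  have h5 := (Finset.sum_eq_zero_iff_of_nonneg (fun j _ => mul_self_nonneg _)).1 h4 j
    (Finset.mem_univ _)
  exact mul_self_eq_zero.1 h5

end GenMetric

end

/-! ### Commutators in dimension four, and adapted orthonormal bases. -/

noncomputable section

section LieAlgebraDimFour

variable {𝔤 : Type*} [LieRing 𝔤] [LieAlgebra ℝ 𝔤]

/-- The functional `X ↦ tr (ad X)`. -/
def traceAd (𝔤 : Type*) [LieRing 𝔤] [LieAlgebra ℝ 𝔤] : Module.Dual ℝ 𝔤 :=
  LinearMap.trace ℝ 𝔤 ∘ₗ (LieAlgebra.ad ℝ 𝔤 : 𝔤 →ₗ[ℝ] Module.End ℝ 𝔤)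

theorem traceAd_apply (e : Module.Basis (Fin 4) ℝ 𝔤) (X : 𝔤) :
    traceAd 𝔤 X = ∑ k, e.coord k ⁅X, e k⁆ := by
  rw [traceAd, LinearMap.comp_apply, LinearMap.trace_eq_matrix_trace ℝ e, Matrix.trace]
  simp [LinearMap.toMatrix_apply]

theorem traceAd_lie (X Y : 𝔤) : traceAd 𝔤 ⁅X, Y⁆ = 0 := by
  change LinearMap.trace ℝ 𝔤 (LieAlgebra.ad ℝ 𝔤 ⁅X, Y⁆) = 0
  rw [LieHom.map_lie, Ring.lie_def, map_sub, LinearMap.trace_mul_comm, sub_self]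

/-- The structure constants of `𝔤` in a basis. -/
def structConst (e : Module.Basis (Fin 4) ℝ 𝔤) (i j k : Fin 4) : ℝ := e.coord k ⁅e i, e j⁆

theorem structConst_skew (e : Module.Basis (Fin 4) ℝ 𝔤) (i j k : Fin 4) :
    structConst e i j k = -structConst e j i k := by
  rw [structConst, ← lie_skew, map_neg, structConst]

theorem structConst_self (e : Module.Basis (Fin 4) ℝ 𝔤) (i k : Fin 4) :
    structConst e i i k = 0 := by
  rw [structConst, lie_self, map_zero]

theorem lie_basis (e : Module.Basis (Fin 4) ℝ 𝔤) (i j : Fin 4) :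
    ⁅e i, e j⁆ = ∑ k, structConst e i j k • e k := (e.sum_repr _).symm

/-- This says `dφ ∧ dφ = 0`: the four-form equals `d(φ ∧ dφ)`, and on a unimodular Lie algebra exact
forms of top degree vanish. -/
theorem pfaffian_eq_zero (e : Module.Basis (Fin 4) ℝ 𝔤) (φ : Module.Dual ℝ 𝔤)
    (hτ : traceAd 𝔤 = 0) :
    φ ⁅e 0, e 1⁆ * φ ⁅e 2, e 3⁆ - φ ⁅e 0, e 2⁆ * φ ⁅e 1, e 3⁆
      + φ ⁅e 0, e 3⁆ * φ ⁅e 1, e 2⁆ = 0 := by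
  have hf : ∀ i j, φ ⁅e i, e j⁆ = ∑ k, structConst e i j k * φ (e k) := by
    intro i j; rw [lie_basis e i j]; simp
  have jac : ∀ i j k, (∑ p, structConst e i j p * φ ⁅e p, e k⁆)
      + (∑ p, structConst e j k p * φ ⁅e p, e i⁆)
      + ∑ p, structConst e k i p * φ ⁅e p, e j⁆ = 0 := by
    intro i j k
    have h1 : ∀ i j k, ∑ p, structConst e i j p * φ ⁅e p, e k⁆ = φ ⁅⁅e i, e j⁆, e k⁆ := by
      intro i j k
      conv_rhs => rw [lie_basis e i j]
      simp [sum_lie]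
    rw [h1, h1, h1, ← map_add, ← map_add, ← lie_skew ⁅e i, e j⁆, ← lie_skew ⁅e j, e k⁆,
      ← lie_skew ⁅e k, e i⁆, ← neg_add, ← neg_add, lie_jacobi, neg_zero, map_zero]
  have tr : ∀ i, ∑ k, structConst e i k k = 0 := by
    intro i
    have := traceAd_apply e (e i)
    rw [hτ] at this
    exact this.symm
  have s10 := fun k => structConst_skew e 1 0 k
  have s20 := fun k => structConst_skew e 2 0 k
  have s30 := fun k => structConst_skew e 3 0 k
  have s21 := fun k => structConst_skew e 2 1 k
  have s31 := fun k => structConst_skew e 3 1 k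
  have s32 := fun k => structConst_skew e 3 2 k
  have t0 := tr 0
  have t1 := tr 1
  have t2 := tr 2
  have t3 := tr 3
  have j0 := jac 1 2 3
  have j1 := jac 0 2 3
  have j2 := jac 0 1 3
  have j3 := jac 0 1 2

  simp only [hf, Fin.sum_univ_four, structConst_self, s10, s20, s30, s21, s31, s32] at *
  let F : Fin 4 → Fin 4 → ℝ := fun i j => structConst e i j 0 * φ (e 0)
    + structConst e i j 1 * φ (e 1) + structConst e i j 2 * φ (e 2) + structConst e i j 3 * φ (e 3)
  -- The Jacobi terms are the components of `φ ∧ d(dφ)`. The trace terms pair the traces of the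
  -- adjoint maps with the components of `φ ∧ dφ`.
  linear_combination (1/2) * φ (e 0) * j0
    + (-1/2) * φ (e 1) * j1
    + (1/2) * φ (e 2) * j2
    + (-1/2) * φ (e 3) * j3
    + (1/2) * (φ (e 1) * F 2 3 - φ (e 2) * F 1 3 + φ (e 3) * F 1 2) * t0
    + (-1/2) * (φ (e 0) * F 2 3 - φ (e 2) * F 0 3 + φ (e 3) * F 0 2) * t1
    + (1/2) * (φ (e 0) * F 1 3 - φ (e 1) * F 0 3 + φ (e 3) * F 0 1) * t2
    + (-1/2) * (φ (e 0) * F 1 2 - φ (e 1) * F 0 2 + φ (e 2) * F 0 1) * t3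

theorem map_lie_eq_zero_of_basis {V : Type*} [AddCommGroup V] [Module ℝ V]
    (e : Module.Basis (Fin 4) ℝ 𝔤) (φ : 𝔤 →ₗ[ℝ] V) (h01 : φ ⁅e 0, e 1⁆ = 0)
    (h02 : φ ⁅e 0, e 2⁆ = 0) (h03 : φ ⁅e 0, e 3⁆ = 0) (h12 : φ ⁅e 1, e 2⁆ = 0)
    (h13 : φ ⁅e 1, e 3⁆ = 0) (h23 : φ ⁅e 2, e 3⁆ = 0) (X Y : 𝔤) : φ ⁅X, Y⁆ = 0 := by
  let B : 𝔤 →ₗ[ℝ] 𝔤 →ₗ[ℝ] V := (LieAlgebra.ad ℝ 𝔤 : 𝔤 →ₗ[ℝ] 𝔤 →ₗ[ℝ] 𝔤).compr₂ φ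
  have sw : ∀ {X Y : 𝔤}, φ ⁅X, Y⁆ = 0 → φ ⁅Y, X⁆ = 0 := by
    intro X Y h; rw [← lie_skew, map_neg, h, neg_zero]
  have hB : B = 0 := by
    refine e.ext fun i => e.ext fun j => ?_
    change φ ⁅e i, e j⁆ = 0
    fin_cases i <;> fin_cases j <;>
      first
      | exact (congrArg φ (lie_self _)).trans (map_zero φ)
      | exact h01 | exact h02 | exact h03 | exact h12 | exact h13 | exact h23
      | exact sw h01 | exact sw h02 | exact sw h03 | exact sw h12 | exact sw h13 | exact sw h23
  exact LinearMap.congr_fun₂ hB X Y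

/-- If `𝔤` is not unimodular, the trace of the adjoint representation serves. Otherwise the
self-dual part of `dφ` imposes three linear conditions on a four-dimensional space of `φ`, so some
nonzero `φ` has `dφ` anti-self-dual. For such a form `dφ ∧ dφ` is a negative multiple of `|dφ|²`,
and it vanishes by `pfaffian_eq_zero`. -/
theorem exists_dual_lie_eq_zero (e : Module.Basis (Fin 4) ℝ 𝔤) :
    ∃ φ : Module.Dual ℝ 𝔤, φ ≠ 0 ∧ ∀ X Y : 𝔤, φ ⁅X, Y⁆ = 0 := by
  by_cases hτ : traceAd 𝔤 = 0
  · have : FiniteDimensional ℝ 𝔤 := e.finiteDimensional_of_finite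
    let T : Module.Dual ℝ 𝔤 →ₗ[ℝ] (Fin 3 → ℝ) := LinearMap.pi
      ![Module.Dual.eval ℝ 𝔤 (⁅e 0, e 1⁆ + ⁅e 2, e 3⁆),
        Module.Dual.eval ℝ 𝔤 (⁅e 0, e 2⁆ - ⁅e 1, e 3⁆),
        Module.Dual.eval ℝ 𝔤 (⁅e 0, e 3⁆ + ⁅e 1, e 2⁆)]
    have hT : LinearMap.ker T ≠ ⊥ := by
      apply LinearMap.ker_ne_bot_of_finrank_lt
      rw [Subspace.dual_finrank_eq, Module.finrank_eq_card_basis e]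
      simp
    obtain ⟨φ, hφ, hφ0⟩ := (Submodule.ne_bot_iff _).1 hT
    refine ⟨φ, hφ0, ?_⟩
    have hφ' : T φ = 0 := hφ
    have h0 : φ ⁅e 0, e 1⁆ + φ ⁅e 2, e 3⁆ = 0 := by simpa [T] using congrFun hφ' 0
    have h1 : φ ⁅e 0, e 2⁆ - φ ⁅e 1, e 3⁆ = 0 := by simpa [T] using congrFun hφ' 1
    have h2 : φ ⁅e 0, e 3⁆ + φ ⁅e 1, e 2⁆ = 0 := by simpa [T] using congrFun hφ' 2
    have hp := pfaffian_eq_zero e φ hτ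
    have hsq : φ ⁅e 0, e 1⁆ ^ 2 + φ ⁅e 0, e 2⁆ ^ 2 + φ ⁅e 0, e 3⁆ ^ 2 = 0 := by
      linear_combination φ ⁅e 0, e 1⁆ * h0 + φ ⁅e 0, e 2⁆ * h1 + φ ⁅e 0, e 3⁆ * h2 - hp
    have z1 : φ ⁅e 0, e 1⁆ = 0 := by
      rw [← sq_eq_zero_iff]; linarith [sq_nonneg (φ ⁅e 0, e 1⁆), sq_nonneg (φ ⁅e 0, e 2⁆),
        sq_nonneg (φ ⁅e 0, e 3⁆)]
    have z2 : φ ⁅e 0, e 2⁆ = 0 := by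
      rw [← sq_eq_zero_iff]; linarith [sq_nonneg (φ ⁅e 0, e 1⁆), sq_nonneg (φ ⁅e 0, e 2⁆),
        sq_nonneg (φ ⁅e 0, e 3⁆)]
    have z3 : φ ⁅e 0, e 3⁆ = 0 := by
      rw [← sq_eq_zero_iff]; linarith [sq_nonneg (φ ⁅e 0, e 1⁆), sq_nonneg (φ ⁅e 0, e 2⁆),
        sq_nonneg (φ ⁅e 0, e 3⁆)]
    have z4 : φ ⁅e 2, e 3⁆ = 0 := by linarith
    have z5 : φ ⁅e 1, e 3⁆ = 0 := by linarith
    have z6 : φ ⁅e 1, e 2⁆ = 0 := by linarith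
    exact map_lie_eq_zero_of_basis e φ z1 z2 z3 z6 z5 z4
  · exact ⟨_, hτ, traceAd_lie⟩

end LieAlgebraDimFour

namespace GenMetric

variable {𝔤 : Type*} [LieRing 𝔤] [LieAlgebra ℝ 𝔤] {M : GenMetric 𝔤}

/-- Values of `v` outside `s` are irrelevant; later uses fill them with placeholders. -/
theorem exists_orthonormal_extension [FiniteDimensional ℝ 𝔤] (hM : M.IsRiemannian)
    (hdim : Module.finrank ℝ 𝔤 = 4) (v : Fin 4 → 𝔤) (s : Set (Fin 4))
    (hv : ∀ i ∈ s, ∀ j ∈ s, M.g (v i) (v j) = if i = j then 1 else 0) :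
    ∃ e : Module.Basis (Fin 4) ℝ 𝔤, IsOrthonormalBasis M.g e ∧ ∀ i ∈ s, e i = v i := by
  let core : InnerProductSpace.Core ℝ 𝔤 :=
    { inner := fun X Y => M.g X Y
      conj_inner_symm := fun X Y => M.symm.eq Y X
      re_inner_nonneg := fun X => by
        by_cases h : X = 0
        · simp [h]
        · exact (hM X h).le
      add_left := fun X Y Z => by simp
      smul_left := fun X Y r => by simp
      definite := fun X h => by
        by_contra hX
        exact (hM X hX).ne' h }
  let _ : NormedAddCommGroup 𝔤 := core.toNormedAddCommGroup
  let _ : InnerProductSpace ℝ 𝔤 := InnerProductSpace.ofCore core.toCore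
  have ho : Orthonormal ℝ (s.domRestrict v) := by
    rw [orthonormal_iff_ite]
    rintro ⟨i, hi⟩ ⟨j, hj⟩
    exact (hv i hi j hj).trans (by simp [Subtype.ext_iff])
  obtain ⟨b, hb⟩ := ho.exists_orthonormalBasis_extension_of_card_eq (by simpa using hdim)
  refine ⟨b.toBasis, fun i j => ?_, fun i hi => ?_⟩
  · have := orthonormal_iff_ite.1 b.orthonormal i j
    rw [OrthonormalBasis.coe_toBasis]
    exact this
  · rw [OrthonormalBasis.coe_toBasis]
    exact hb i hi

theorem orthonormal_coord {e : Module.Basis (Fin 4) ℝ 𝔤} (he : IsOrthonormalBasis M.g e)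
    (k : Fin 4) (X : 𝔤) : e.coord k X = M.g X (e k) := by
  conv_rhs => rw [← e.sum_repr X]
  simp only [map_sum, map_smul, LinearMap.sum_apply, LinearMap.smul_apply, he _ k, smul_eq_mul,
    mul_ite, mul_one, mul_zero, Finset.sum_ite_eq', Finset.mem_univ, if_true]
  rfl

variable [FiniteDimensional ℝ 𝔤]

theorem exists_unit_of_dual (hM : M.IsRiemannian) {φ : Module.Dual ℝ 𝔤} (hφ : φ ≠ 0) :
    ∃ (v : 𝔤) (r : ℝ), M.g v v = 1 ∧ r ≠ 0 ∧ ∀ X, φ X = r * M.g X v := by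
  set w := (M.g.toDual M.nondegenerate).symm φ with hw
  have hw0 : w ≠ 0 := by
    rw [hw]; simpa using hφ
  have h1 : ∀ X, φ X = M.g X w := by
    intro X
    have : M.g.toDual M.nondegenerate w = φ := by rw [hw, LinearEquiv.apply_symm_apply]
    rw [← this, LinearMap.BilinForm.toDual_def]
    exact M.symm.eq _ _
  have h2 := hM w hw0
  have h3 := Real.sqrt_pos.2 h2
  have h4 := Real.mul_self_sqrt h2.le
  set r := Real.sqrt (M.g w w)
  refine ⟨r⁻¹ • w, r, ?_, h3.ne', ?_⟩
  · simp only [map_smul, LinearMap.smul_apply, smul_eq_mul, ← h4]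
    field_simp
  · intro X
    simp only [map_smul, smul_eq_mul, h1]
    field_simp

theorem exists_unit_orthogonal_commutator (hM : M.IsRiemannian)
    (hdim : Module.finrank ℝ 𝔤 = 4) :
    ∃ v : 𝔤, M.g v v = 1 ∧ ∀ X Y : 𝔤, M.g ⁅X, Y⁆ v = 0 := by
  obtain ⟨φ, hφ, h⟩ := exists_dual_lie_eq_zero (Module.finBasisOfFinrankEq ℝ 𝔤 hdim)
  obtain ⟨v, r, hv, hr, h1⟩ := exists_unit_of_dual hM hφ
  refine ⟨v, hv, fun X Y => ?_⟩
  have := h X Y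
  rw [h1] at this
  exact (mul_eq_zero.1 this).resolve_left hr

end GenMetric

end

/-! ### Structure constants, and directions orthogonal to the commutators. -/

noncomputable section

theorem structConst_jacobi {𝔤 : Type*} [LieRing 𝔤] [LieAlgebra ℝ 𝔤]
    (e : Module.Basis (Fin 4) ℝ 𝔤) (i j k l : Fin 4) :
    (∑ p, structConst e i j p * structConst e p k l)
      + (∑ p, structConst e j k p * structConst e p i l)
      + ∑ p, structConst e k i p * structConst e p j l = 0 := by
  have h1 : ∀ i j k, ∑ p, structConst e i j p * structConst e p k l =
      e.coord l ⁅⁅e i, e j⁆, e k⁆ := by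
    intro i j k
    conv_rhs => rw [lie_basis e i j]
    simp only [sum_lie, smul_lie, map_sum, map_smul, smul_eq_mul]
    rfl
  rw [h1, h1, h1, ← map_add, ← map_add, ← lie_skew ⁅e i, e j⁆, ← lie_skew ⁅e j, e k⁆,
    ← lie_skew ⁅e k, e i⁆, ← neg_add, ← neg_add, lie_jacobi, neg_zero, map_zero]

theorem wedge3_apply {𝔤 : Type*} [AddCommGroup 𝔤] [Module ℝ 𝔤] (α β γ : Module.Dual ℝ 𝔤)
    (X Y Z : 𝔤) : wedge3 α β γ ![X, Y, Z] =
      Matrix.det !![α X, β X, γ X; α Y, β Y, γ Y; α Z, β Z, γ Z] := by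
  change Matrix.det (fun i => LinearMap.pi ![α, β, γ] (![X, Y, Z] i)) = _
  congr 1
  ext i j
  fin_cases i <;> fin_cases j <;> rfl

namespace GenMetric

variable {𝔤 : Type*} [LieRing 𝔤] [LieAlgebra ℝ 𝔤]

/-- The components of the three-form in a basis. -/
def formConst (M : GenMetric 𝔤) (e : Module.Basis (Fin 4) ℝ 𝔤) (i j k : Fin 4) : ℝ :=
  M.H ![e i, e j, e k]

theorem formConst_swap_left (M : GenMetric 𝔤) (e : Module.Basis (Fin 4) ℝ 𝔤) (i j k : Fin 4) :
    M.formConst e j i k = -M.formConst e i j k := alternating_swap_left _ _ _ _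

theorem formConst_swap_right (M : GenMetric 𝔤) (e : Module.Basis (Fin 4) ℝ 𝔤) (i j k : Fin 4) :
    M.formConst e i k j = -M.formConst e i j k := alternating_swap_right _ _ _ _

theorem formConst_self_left (M : GenMetric 𝔤) (e : Module.Basis (Fin 4) ℝ 𝔤) (i k : Fin 4) :
    M.formConst e i i k = 0 := by
  linarith [M.formConst_swap_left e i i k]

theorem formConst_self_right (M : GenMetric 𝔤) (e : Module.Basis (Fin 4) ℝ 𝔤) (i k : Fin 4) :
    M.formConst e i k k = 0 := by
  linarith [M.formConst_swap_right e i k k]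

theorem formConst_self_outer (M : GenMetric 𝔤) (e : Module.Basis (Fin 4) ℝ 𝔤) (i k : Fin 4) :
    M.formConst e i k i = 0 := by
  rw [formConst_swap_right, formConst_self_left, neg_zero]

theorem dorfmanForm_frameVec (M : GenMetric 𝔤) (e : Module.Basis (Fin 4) ℝ 𝔤) (s t r : ℝ)
    (i j k : Fin 4) :
    M.dorfmanForm (frameVec e s i) (frameVec e t j) (frameVec e r k) =
      (1 / 2) * (r * structConst e i j k + s * structConst e j k i + t * structConst e k i j
        + M.formConst e i j k) := by
  simp only [dorfmanForm_apply, frameVec, LinearMap.smul_apply, smul_eq_mul, structConst,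
    formConst]

variable {M : GenMetric 𝔤} {e : Module.Basis (Fin 4) ℝ 𝔤}

/-- When no bracket has a component along `e i`, the diagonal Ricci entry is minus a sum of squares
of `(H_{imk} + c_{ikm} + c_{imk}) / 2`. Each summand vanishes, and its parts symmetric and skew in
`k, m` are the two conclusions. -/
theorem skew_of_frameRicci_eq_zero {i : Fin 4} (hQ : M.frameRicci e i i = 0)
    (hi : ∀ j k, structConst e j k i = 0) (k m : Fin 4) :
    structConst e i k m = -structConst e i m k ∧ M.formConst e i k m = 0 := by
  have h : ∀ k m, M.dorfmanForm (frameVec e 1 k) (frameVec e (-1) i) (frameVec e (-1) m)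
      * M.dorfmanForm (frameVec e (-1) m) (frameVec e 1 i) (frameVec e 1 k) =
      -((1 / 2) * (M.formConst e i m k + structConst e i k m + structConst e i m k)) ^ 2 := by
    intro k m
    rw [dorfmanForm_frameVec, dorfmanForm_frameVec, hi, hi, structConst_skew e k i m,
      structConst_skew e m i k, M.formConst_swap_left e i k m, M.formConst_swap_left e i m k,
      M.formConst_swap_right e i m k]
    ring
  simp only [frameRicci, h, Finset.sum_neg_distrib, neg_eq_zero] at hQ
  have h' : ∀ k m, M.formConst e i m k + structConst e i k m + structConst e i m k = 0 := by
    intro k m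
    have h4 := (Finset.sum_eq_zero_iff_of_nonneg
      (fun i _ => Finset.sum_nonneg fun j _ => sq_nonneg _)).1 hQ k (Finset.mem_univ _)
    have h5 := (Finset.sum_eq_zero_iff_of_nonneg (fun j _ => sq_nonneg _)).1 h4 m
      (Finset.mem_univ _)
    have := pow_eq_zero_iff (two_ne_zero) |>.1 h5
    linarith
  have h1 := h' k m
  have h2 := h' m k
  have h3 := M.formConst_swap_right e i k m
  constructor <;> linarith

variable [FiniteDimensional ℝ 𝔤] {δ : Module.Dual ℝ (GenTangent 𝔤)}

omit [FiniteDimensional ℝ 𝔤] in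
theorem structConst_eq_zero_of_orthogonal (he : IsOrthonormalBasis M.g e) {k : Fin 4}
    (hk : ∀ X Y : 𝔤, M.g ⁅X, Y⁆ (e k) = 0) (i j : Fin 4) : structConst e i j k = 0 := by
  rw [structConst, orthonormal_coord he]; exact hk _ _

theorem IsGenEinstein.skew (hE : M.IsGenEinstein δ) (he : IsOrthonormalBasis M.g e) {i : Fin 4}
    (hi : ∀ X Y : 𝔤, M.g ⁅X, Y⁆ (e i) = 0) (k m : Fin 4) :
    structConst e i k m = -structConst e i m k ∧ M.formConst e i k m = 0 :=
  skew_of_frameRicci_eq_zero (hE.frameRicci_eq_zero he i i)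
    (structConst_eq_zero_of_orthogonal he hi) k m

/-- The vector dual to a nonzero trace functional would be orthogonal to the commutators. Its
adjoint map is then skew, hence traceless, while the functional is nonzero on it. -/
theorem IsGenEinstein.traceAd_eq_zero (hE : M.IsGenEinstein δ) (hM : M.IsRiemannian)
    (hdim : Module.finrank ℝ 𝔤 = 4) : traceAd 𝔤 = 0 := by
  by_contra h
  obtain ⟨v, r, hv, hr, h1⟩ := exists_unit_of_dual hM h
  obtain ⟨e, he, hev⟩ := exists_orthonormal_extension hM hdim (fun _ => v) {3}
    (by rintro i rfl j rfl; simpa using hv)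
  have h3 : e 3 = v := hev 3 rfl
  have hv' : ∀ X Y : 𝔤, M.g ⁅X, Y⁆ (e 3) = 0 := by
    intro X Y
    have := traceAd_lie X Y
    rw [h1, ← h3] at this
    exact (mul_eq_zero.1 this).resolve_left hr
  have h4 := h1 v
  rw [hv, mul_one, ← h3, traceAd_apply e] at h4
  apply hr
  rw [← h4]
  refine Finset.sum_eq_zero fun k _ => ?_
  have := (hE.skew he hv' k k).1
  rw [structConst] at this
  linarith

omit [FiniteDimensional ℝ 𝔤] in
theorem form_eq_of_formConst (h : ∀ j k, M.formConst e 3 j k = 0) :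
    M.H = M.formConst e 0 1 2 • wedge3 (e.coord 0) (e.coord 1) (e.coord 2) := by
  refine e.ext_alternating fun v _ => ?_
  have hv : (fun i => e (v i)) = ![e (v 0), e (v 1), e (v 2)] := by
    ext i; fin_cases i <;> rfl
  rw [hv, AlternatingMap.smul_apply]
  change M.formConst e (v 0) (v 1) (v 2) = _
  rw [wedge3_apply, Matrix.det_fin_three]
  have h' : ∀ j k, M.formConst e j 3 k = 0 := fun j k => by
    rw [formConst_swap_left, h, neg_zero]
  have h'' : ∀ j k, M.formConst e j k 3 = 0 := fun j k => by
    rw [formConst_swap_right, h', neg_zero]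
  have p1 := M.formConst_swap_left e 0 1 2
  have p2 := M.formConst_swap_right e 0 1 2
  have p3 := M.formConst_swap_right e 1 0 2
  have p4 := M.formConst_swap_left e 0 2 1
  have p5 := M.formConst_swap_right e 2 0 1
  rw [p1] at p3
  rw [p2] at p4
  rw [p4] at p5
  generalize v 0 = i
  generalize v 1 = j
  generalize v 2 = k
  fin_cases i <;> fin_cases j <;> fin_cases k <;>
    simp [h, h', h'', formConst_self_left, formConst_self_right, formConst_self_outer, p1, p2, p3,
      p4, p5]

end GenMetric

end

/-! ### The bracket on the hyperplane as a symmetric matrix. -/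

noncomputable section

namespace GenMetric

variable {𝔤 : Type*} [LieRing 𝔤] [LieAlgebra ℝ 𝔤] [FiniteDimensional ℝ 𝔤] {M : GenMetric 𝔤}
  {e : Module.Basis (Fin 4) ℝ 𝔤} {δ : Module.Dual ℝ (GenTangent 𝔤)}

set_option maxHeartbeats 1000000 in
/-- The bracket on `e₃^⊥`, for a unit vector `e₃` orthogonal to the commutator ideal, is given by
`[eᵢ, eⱼ] = ∑ εᵢⱼₖ (tr m - m) eₖ` for a symmetric matrix `m`, and the Einstein condition says that
the adjugate of `m` is a multiple of the identity. -/
theorem IsGenEinstein.normal_form (hE : M.IsGenEinstein δ) (hM : M.IsRiemannian)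
    (hdim : Module.finrank ℝ 𝔤 = 4) (he : IsOrthonormalBasis M.g e)
    (h3 : ∀ X Y : 𝔤, M.g ⁅X, Y⁆ (e 3) = 0) :
    ∃ m00 m11 m22 m01 m02 m12 : ℝ,
      (structConst e 0 1 0 = -m02 ∧ structConst e 0 1 1 = -m12 ∧
        structConst e 0 1 2 = m00 + m11) ∧
      (structConst e 1 2 0 = m11 + m22 ∧ structConst e 1 2 1 = -m01 ∧
        structConst e 1 2 2 = -m02) ∧
      (structConst e 0 2 0 = m01 ∧ structConst e 0 2 1 = -(m00 + m22) ∧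
        structConst e 0 2 2 = m12) ∧
      m11 * m22 - m12 ^ 2 = M.formConst e 0 1 2 ^ 2 / 4 ∧
      m00 * m22 - m02 ^ 2 = M.formConst e 0 1 2 ^ 2 / 4 ∧
      m00 * m11 - m01 ^ 2 = M.formConst e 0 1 2 ^ 2 / 4 ∧
      m01 * m02 - m00 * m12 = 0 ∧ m12 * m01 - m02 * m11 = 0 ∧ m02 * m12 - m01 * m22 = 0 := by
  have c3 := structConst_eq_zero_of_orthogonal he h3
  have sk := fun j k => (hE.skew he h3 j k).1
  have h3jk := fun j k => (hE.skew he h3 j k).2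
  have hj3k : ∀ j k, M.formConst e j 3 k = 0 := fun j k => by
    rw [formConst_swap_left, h3jk, neg_zero]
  have hjk3 : ∀ j k, M.formConst e j k 3 = 0 := fun j k => by
    rw [formConst_swap_right, hj3k, neg_zero]
  have p1 := M.formConst_swap_left e 0 1 2
  have p2 := M.formConst_swap_right e 0 1 2
  have p3 := M.formConst_swap_right e 1 0 2
  have p4 := M.formConst_swap_left e 0 2 1
  have p5 := M.formConst_swap_right e 2 0 1
  rw [p1] at p3
  rw [p2] at p4
  rw [p4] at p5
  have self := structConst_self e
  have s10 := fun k => structConst_skew e 1 0 k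
  have s20 := fun k => structConst_skew e 2 0 k
  have s21 := fun k => structConst_skew e 2 1 k
  have s03 := fun k => structConst_skew e 0 3 k
  have s13 := fun k => structConst_skew e 1 3 k
  have s23 := fun k => structConst_skew e 2 3 k
  have k0 : structConst e 3 0 0 = 0 := by linarith [sk 0 0]
  have k1 : structConst e 3 1 1 = 0 := by linarith [sk 1 1]
  have k2 : structConst e 3 2 2 = 0 := by linarith [sk 2 2]
  have k10 := sk 1 0
  have k20 := sk 2 0
  have k21 := sk 2 1
  have tr : ∀ i, ∑ k, structConst e i k k = 0 := by
    intro i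
    have := traceAd_apply e (e i)
    rw [hE.traceAd_eq_zero hM hdim] at this
    exact this.symm
  have t0 := tr 0
  have t1 := tr 1
  have t2 := tr 2
  simp only [Fin.sum_univ_four, self, c3, s10, s20, s21] at t0 t1 t2
  -- Unimodularity is what makes the matrix `m` symmetric.
  have r0 : structConst e 0 2 2 = -structConst e 0 1 1 := by linarith
  have r1 : structConst e 1 2 2 = structConst e 0 1 0 := by linarith
  have r2 : structConst e 1 2 1 = -structConst e 0 2 0 := by linarith
  have ric := hE.frameRicci_eq_zero he
  simp only [frameRicci, dorfmanForm_frameVec, Fin.sum_univ_four] at ric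
  have q00 := ric 0 0
  have q11 := ric 1 1
  have q22 := ric 2 2
  have q01 := ric 0 1
  have q02 := ric 0 2
  have q12 := ric 1 2
  clear ric
  simp only [self, c3, s10, s20, s21, s03, s13, s23, k0, k1, k2, k10, k20, k21, r0, r1, r2,
    h3jk, hjk3, formConst_self_left, formConst_self_right, formConst_self_outer, p1, p2, p3,
    p4, p5, mul_zero, zero_mul, add_zero, zero_add, neg_zero, one_mul] at q00 q11 q22 q01 q02 q12
  -- The diagonal entries of `m` solve `m00 + m11 = c012`, `m11 + m22 = c120`, `m00 + m22 = -c021`,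
  -- where `cijk` is the structure constant.
  refine ⟨(-structConst e 1 2 0 - structConst e 0 2 1 + structConst e 0 1 2) / 2,
    (structConst e 1 2 0 + structConst e 0 2 1 + structConst e 0 1 2) / 2,
    (structConst e 1 2 0 - structConst e 0 2 1 - structConst e 0 1 2) / 2,
    structConst e 0 2 0, -structConst e 0 1 0, -structConst e 0 1 1,
    ⟨by ring, by ring, by ring⟩, ⟨by ring, by linarith, by linarith⟩,
    ⟨by ring, by ring, by linarith⟩, ?_, ?_, ?_, ?_, ?_, ?_⟩
  · linear_combination q00 / 2
  · linear_combination q11 / 2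
  · linear_combination q22 / 2
  · linear_combination q12 / 2
  · linear_combination q02 / 2
  · linear_combination q01 / 2

end GenMetric

end

/-! ### Vanishing three-form: a second direction orthogonal to the commutators. -/

noncomputable section

namespace GenMetric

variable {𝔤 : Type*} [LieRing 𝔤] [LieAlgebra ℝ 𝔤] {M : GenMetric 𝔤}
  {e : Module.Basis (Fin 4) ℝ 𝔤}

theorem isOrthonormalBasis_reindex (he : IsOrthonormalBasis M.g e) (σ : Equiv.Perm (Fin 4)) :
    IsOrthonormalBasis M.g (e.reindex σ) := by
  intro i j
  rw [Module.Basis.reindex_apply, Module.Basis.reindex_apply, he]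
  simp

theorem structConst_reindex (σ : Equiv.Perm (Fin 4)) (i j k : Fin 4) :
    structConst (e.reindex σ) i j k = structConst e (σ.symm i) (σ.symm j) (σ.symm k) := by
  simp [structConst]

theorem dual_apply_lie (φ : Module.Dual ℝ 𝔤) (i j : Fin 4) :
    φ ⁅e i, e j⁆ = ∑ k, structConst e i j k * φ (e k) := by
  rw [lie_basis e i j]; simp

variable [FiniteDimensional ℝ 𝔤] {δ : Module.Dual ℝ (GenTangent 𝔤)}

/-- For `H = 0` the adjugate of `m` vanishes, so `m` has rank at most one, and the pivot in `hp` is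
`2 * m00`. The functional is the first row of `m`. It kills brackets in the hyperplane because `m² =
(tr m) m`. It kills `[e₃, ·]` (zero-based index) because Jacobi makes the skew map `ad e₃`
compatible with `m`, so `ad e₃` annihilates the line spanned by that row. -/
theorem IsGenEinstein.exists_dual_of_pivot (hE : M.IsGenEinstein δ) (hM : M.IsRiemannian)
    (hdim : Module.finrank ℝ 𝔤 = 4) (hH : M.H = 0) (he : IsOrthonormalBasis M.g e)
    (h3 : ∀ X Y : 𝔤, M.g ⁅X, Y⁆ (e 3) = 0)
    (hp : structConst e 0 1 2 - structConst e 1 2 0 - structConst e 0 2 1 ≠ 0) :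
    ∃ φ : Module.Dual ℝ 𝔤, φ ≠ 0 ∧ φ (e 3) = 0 ∧ ∀ X Y : 𝔤, φ ⁅X, Y⁆ = 0 := by
  obtain ⟨m00, m11, m22, m01, m02, m12, ⟨c010, c011, c012⟩, ⟨c120, c121, c122⟩,
    ⟨c020, c021, c022⟩, e0, e1, e2, e3, e4, e5⟩ := hE.normal_form hM hdim he h3
  have hf : M.formConst e 0 1 2 = 0 := by simp [formConst, hH]
  simp only [hf] at e0 e1 e2
  have c3 := structConst_eq_zero_of_orthogonal he h3
  have sk := fun j k => (hE.skew he h3 j k).1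
  have self := structConst_self e
  have s21 := fun k => structConst_skew e 2 1 k
  have s03 := fun k => structConst_skew e 0 3 k
  have s13 := fun k => structConst_skew e 1 3 k
  have s23 := fun k => structConst_skew e 2 3 k
  have k0 : structConst e 3 0 0 = 0 := by linarith [sk 0 0]
  have k1 : structConst e 3 1 1 = 0 := by linarith [sk 1 1]
  have k2 : structConst e 3 2 2 = 0 := by linarith [sk 2 2]
  have k10 := sk 1 0
  have k20 := sk 2 0
  have k21 := sk 2 1
  have hp0 : m00 ≠ 0 := by
    intro h
    apply hp
    rw [c012, c120, c021, h]; ring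
  let φ : Module.Dual ℝ 𝔤 := m00 • e.coord 0 + m01 • e.coord 1 + m02 • e.coord 2
  have v0 : φ (e 0) = m00 := by simp [φ]
  have v1 : φ (e 1) = m01 := by simp [φ]
  have v2 : φ (e 2) = m02 := by simp [φ]
  have v3 : φ (e 3) = 0 := by simp [φ]
  have j0 := structConst_jacobi e 3 1 2 0
  have j1 := structConst_jacobi e 3 1 2 1
  have j2 := structConst_jacobi e 3 1 2 2
  simp only [Fin.sum_univ_four, self, c3, s21, s03, s13, s23, k0, k1, k2, k10, k20, k21,
    c010, c011, c012, c120, c121, c122, c020, c021, c022] at j0 j1 j2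
  -- The first component of the statement that `ad e₃` annihilates the first row of `m`; the other
  -- two follow after multiplication by the pivot.
  have w0 : structConst e 3 0 1 * m01 + structConst e 3 0 2 * m02 = 0 := by
    linear_combination -j0 / 2
  refine ⟨φ, fun h => hp0 (by rw [← v0, h]; rfl), v3, ?_⟩
  refine map_lie_eq_zero_of_basis e φ ?_ ?_ ?_ ?_ ?_ ?_
  all_goals
    rw [dual_apply_lie]
    simp only [Fin.sum_univ_four, c3, s03, s13, s23, k0, k1, k2, k10, k20,
      k21, c010, c011, c012, c120, c121, c122, c020, c021, c022, v0, v1, v2, v3]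
  · linear_combination -e4
  · linear_combination e5
  · linear_combination -w0
  · linear_combination e1 + e2
  · apply mul_left_cancel₀ hp0
    linear_combination m01 * w0 + m00 * j1 + structConst e 3 0 1 * e2 - structConst e 3 0 2 * e3
  · apply mul_left_cancel₀ hp0
    linear_combination m02 * w0 + m00 * j2 - structConst e 3 0 1 * e3 + structConst e 3 0 2 * e1

/-- A nonzero diagonal entry of `m` can be permuted into the pivot position. If all three vanish,
the vanishing principal minors give `m = 0`, so the hyperplane is Abelian and only the skew map `ad
e₃` is left. Its axis is orthogonal to its image. -/
theorem IsGenEinstein.exists_dual_of_form_eq_zero (hE : M.IsGenEinstein δ) (hM : M.IsRiemannian)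
    (hdim : Module.finrank ℝ 𝔤 = 4) (hH : M.H = 0) (he : IsOrthonormalBasis M.g e)
    (h3 : ∀ X Y : 𝔤, M.g ⁅X, Y⁆ (e 3) = 0) :
    ∃ φ : Module.Dual ℝ 𝔤, φ ≠ 0 ∧ φ (e 3) = 0 ∧ ∀ X Y : 𝔤, φ ⁅X, Y⁆ = 0 := by
  by_cases p0 : structConst e 0 1 2 - structConst e 1 2 0 - structConst e 0 2 1 = 0
  swap
  · exact hE.exists_dual_of_pivot hM hdim hH he h3 p0
  have perm : ∀ σ : Equiv.Perm (Fin 4), σ.symm 3 = 3 →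
      structConst e (σ.symm 0) (σ.symm 1) (σ.symm 2) - structConst e (σ.symm 1) (σ.symm 2) (σ.symm 0)
        - structConst e (σ.symm 0) (σ.symm 2) (σ.symm 1) ≠ 0 →
      ∃ φ : Module.Dual ℝ 𝔤, φ ≠ 0 ∧ φ (e 3) = 0 ∧ ∀ X Y : 𝔤, φ ⁅X, Y⁆ = 0 := by
    intro σ hσ hp
    have h3' : e.reindex σ 3 = e 3 := by rw [Module.Basis.reindex_apply, hσ]
    have := hE.exists_dual_of_pivot hM hdim hH (isOrthonormalBasis_reindex he σ)
      (by rw [h3']; exact h3) (by simpa only [structConst_reindex] using hp)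
    rwa [h3'] at this
  by_cases p1 : structConst e 1 0 2 - structConst e 0 2 1 - structConst e 1 2 0 = 0
  swap
  · exact perm (Equiv.swap 0 1) (by decide) p1
  by_cases p2 : structConst e 2 1 0 - structConst e 1 0 2 - structConst e 2 0 1 = 0
  swap
  · exact perm (Equiv.swap 0 2) (by decide) p2
  obtain ⟨m00, m11, m22, m01, m02, m12, ⟨c010, c011, c012⟩, ⟨c120, c121, c122⟩,
    ⟨c020, c021, c022⟩, e0, e1, e2, -, -, -⟩ := hE.normal_form hM hdim he h3
  have hf : M.formConst e 0 1 2 = 0 := by simp [formConst, hH]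
  simp only [hf] at e0 e1 e2
  rw [structConst_skew e 1 0] at p1 p2
  rw [structConst_skew e 2 1, structConst_skew e 2 0] at p2
  rw [c012, c120, c021] at p0 p1 p2
  have z0 : m00 = 0 := by linarith
  have z1 : m11 = 0 := by linarith
  have z2 : m22 = 0 := by linarith
  have z01 : m01 = 0 := by rw [← sq_eq_zero_iff]; rw [z0] at e2; linarith
  have z02 : m02 = 0 := by rw [← sq_eq_zero_iff]; rw [z0] at e1; linarith
  have z12 : m12 = 0 := by rw [← sq_eq_zero_iff]; rw [z1] at e0; linarith
  subst z0 z1 z2 z01 z02 z12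
  have c3 := structConst_eq_zero_of_orthogonal he h3
  have sk := fun j k => (hE.skew he h3 j k).1
  have s03 := fun k => structConst_skew e 0 3 k
  have s13 := fun k => structConst_skew e 1 3 k
  have s23 := fun k => structConst_skew e 2 3 k
  have k0 : structConst e 3 0 0 = 0 := by linarith [sk 0 0]
  have k1 : structConst e 3 1 1 = 0 := by linarith [sk 1 1]
  have k2 : structConst e 3 2 2 = 0 := by linarith [sk 2 2]
  have k10 := sk 1 0
  have k20 := sk 2 0
  have k21 := sk 2 1
  by_cases hA : structConst e 3 0 1 = 0 ∧ structConst e 3 0 2 = 0 ∧ structConst e 3 1 2 = 0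
  · obtain ⟨a1, a2, a3⟩ := hA
    refine ⟨e.coord 0, ?_, by simp, map_lie_eq_zero_of_basis e _ ?_ ?_ ?_ ?_ ?_ ?_⟩
    · intro h
      simpa using LinearMap.congr_fun h (e 0)
    all_goals
      rw [dual_apply_lie]
      simp [Fin.sum_univ_four, c3, s03, s13, s23, k0, k1, k2, k10, k20, k21, c010, c011, c012,
        c120, c121, c122, c020, c021, c022, a1, a2, a3]
  -- The coefficients are those of the axis of the skew `3 × 3` matrix of `ad e₃`.
  · let φ : Module.Dual ℝ 𝔤 := structConst e 3 1 2 • e.coord 0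
      + (-structConst e 3 0 2) • e.coord 1 + structConst e 3 0 1 • e.coord 2
    have v0 : φ (e 0) = structConst e 3 1 2 := by simp [φ]
    have v1 : φ (e 1) = -structConst e 3 0 2 := by simp [φ]
    have v2 : φ (e 2) = structConst e 3 0 1 := by simp [φ]
    have v3 : φ (e 3) = 0 := by simp [φ]
    refine ⟨φ, ?_, v3, map_lie_eq_zero_of_basis e _ ?_ ?_ ?_ ?_ ?_ ?_⟩
    · intro h
      refine hA ⟨?_, ?_, ?_⟩
      · rw [← v2, h]; rfl
      · rw [← neg_eq_zero, ← v1, h]; rfl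
      · rw [← v0, h]; rfl
    all_goals
      rw [dual_apply_lie]
      simp only [Fin.sum_univ_four, c3, s03, s13, s23, k0, k1, k2, k10, k20, k21, c010, c011, c012,
        c120, c121, c122, c020, c021, c022, v0, v1, v2, v3]
      ring

end GenMetric

end

/-! ### Classification of the Lie brackets. -/

noncomputable section

namespace GenMetric

variable {𝔤 : Type*} [LieRing 𝔤] [LieAlgebra ℝ 𝔤] [FiniteDimensional ℝ 𝔤] {M : GenMetric 𝔤}
  {e : Module.Basis (Fin 4) ℝ 𝔤} {δ : Module.Dual ℝ (GenTangent 𝔤)}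

/-- Both adjoint maps are skew with image in the plane of `e 0, e 1`, so they are infinitesimal
rotations of it. Skewness also kills `[e 2, e 3]`, and unimodularity kills `[e 0, e 1]`. -/
theorem IsGenEinstein.lie_of_codim_two (hE : M.IsGenEinstein δ) (hM : M.IsRiemannian)
    (hdim : Module.finrank ℝ 𝔤 = 4) (he : IsOrthonormalBasis M.g e)
    (h2 : ∀ X Y : 𝔤, M.g ⁅X, Y⁆ (e 2) = 0) (h3 : ∀ X Y : 𝔤, M.g ⁅X, Y⁆ (e 3) = 0) :
    ⁅e 2, e 0⁆ = structConst e 2 0 1 • e 1 ∧ ⁅e 2, e 1⁆ = -(structConst e 2 0 1 • e 0) ∧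
    ⁅e 3, e 0⁆ = structConst e 3 0 1 • e 1 ∧ ⁅e 3, e 1⁆ = -(structConst e 3 0 1 • e 0) ∧
    ⁅e 0, e 1⁆ = 0 ∧ ⁅e 2, e 3⁆ = 0 := by
  have c2 := structConst_eq_zero_of_orthogonal he h2
  have c3 := structConst_eq_zero_of_orthogonal he h3
  have sk2 := fun j k => (hE.skew he h2 j k).1
  have sk3 := fun j k => (hE.skew he h3 j k).1
  have tr : ∀ i, ∑ k, structConst e i k k = 0 := by
    intro i
    have := traceAd_apply e (e i)
    rw [hE.traceAd_eq_zero hM hdim] at this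
    exact this.symm
  have t0 := tr 0
  have t1 := tr 1
  simp only [Fin.sum_univ_four, structConst_self, c2, c3] at t0 t1
  have k1 : structConst e 0 1 1 = 0 := by linarith
  have k2 : structConst e 0 1 0 = 0 := by rw [structConst_skew]; linarith
  have k3 : structConst e 2 0 0 = 0 := by linarith [sk2 0 0]
  have k4 : structConst e 2 1 1 = 0 := by linarith [sk2 1 1]
  have k5 : structConst e 3 0 0 = 0 := by linarith [sk3 0 0]
  have k6 : structConst e 3 1 1 = 0 := by linarith [sk3 1 1]
  have k7 : ∀ k, structConst e 2 3 k = 0 := fun k => by rw [sk2, c3, neg_zero]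
  refine ⟨?_, ?_, ?_, ?_, ?_, ?_⟩ <;> rw [lie_basis e] <;>
    simp [Fin.sum_univ_four, c2, c3, k1, k2, k3, k4, k5, k6, k7, sk2 1 0, sk3 1 0]

theorem IsGenEinstein.exists_codim_two (hE : M.IsGenEinstein δ) (hM : M.IsRiemannian)
    (hdim : Module.finrank ℝ 𝔤 = 4) (hH : M.H = 0) :
    ∃ e : Module.Basis (Fin 4) ℝ 𝔤, IsOrthonormalBasis M.g e ∧
      (∀ X Y : 𝔤, M.g ⁅X, Y⁆ (e 2) = 0) ∧ ∀ X Y : 𝔤, M.g ⁅X, Y⁆ (e 3) = 0 := by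
  obtain ⟨v, hv, hv'⟩ := exists_unit_orthogonal_commutator hM hdim
  obtain ⟨e, he, hev⟩ := exists_orthonormal_extension hM hdim (fun _ => v) {3}
    (by rintro i rfl j rfl; simpa using hv)
  have h3 : e 3 = v := hev 3 rfl
  obtain ⟨φ, hφ, hφ3, hφ'⟩ := hE.exists_dual_of_form_eq_zero hM hdim hH he (by rwa [h3])
  obtain ⟨u, r, hu, hr, h1⟩ := exists_unit_of_dual hM hφ
  have huv : M.g v u = 0 := by
    rw [h1, h3] at hφ3
    exact (mul_eq_zero.1 hφ3).resolve_left hr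
  have huv' : M.g u v = 0 := (M.symm.eq v u).symm.trans huv
  obtain ⟨f, hf, hfv⟩ := exists_orthonormal_extension hM hdim ![v, v, u, v] {2, 3}
    (by rintro i (rfl | rfl) j (rfl | rfl) <;> simp [hu, hv, huv, huv'])
  have f2 : f 2 = u := hfv 2 (by simp)
  have f3 : f 3 = v := hfv 3 (by simp)
  refine ⟨f, hf, fun X Y => ?_, fun X Y => ?_⟩
  · have := hφ' X Y
    rw [h1] at this
    rw [f2]
    exact (mul_eq_zero.1 this).resolve_left hr
  · rw [f3]; exact hv' X Y

/-- The directions `e 2, e 3` rotate one plane at speeds `α, β`. Turning them in their own plane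
puts all rotation into one vector and makes the other central. Exchanging the first two basis
vectors fixes the sign of the speed. -/
theorem IsGenEinstein.flat_classification (hE : M.IsGenEinstein δ) (hM : M.IsRiemannian)
    (hdim : Module.finrank ℝ 𝔤 = 4) (hH : M.H = 0) :
    (∀ X Y : 𝔤, ⁅X, Y⁆ = 0) ∨
    ∃ (e : Module.Basis (Fin 4) ℝ 𝔤) (a : ℝ), IsOrthonormalBasis M.g e ∧ 0 < a ∧
      ⁅e 2, e 0⁆ = a • e 1 ∧ ⁅e 2, e 1⁆ = -(a • e 0) ∧
      ⁅e 0, e 1⁆ = 0 ∧ ⁅e 0, e 3⁆ = 0 ∧ ⁅e 1, e 3⁆ = 0 ∧ ⁅e 2, e 3⁆ = 0 := by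
  obtain ⟨e, he, h2, h3⟩ := hE.exists_codim_two hM hdim hH
  obtain ⟨l20, l21, l30, l31, l01, l23⟩ := hE.lie_of_codim_two hM hdim he h2 h3
  generalize structConst e 2 0 1 = α at l20 l21
  generalize structConst e 3 0 1 = β at l30 l31
  by_cases h0 : α = 0 ∧ β = 0
  · left
    obtain ⟨rfl, rfl⟩ := h0
    refine map_lie_eq_zero_of_basis e LinearMap.id ?_ ?_ ?_ ?_ ?_ ?_ <;>
      rw [LinearMap.id_apply]
    · exact l01
    · rw [← lie_skew, l20]; simp
    · rw [← lie_skew, l30]; simp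
    · rw [← lie_skew, l21]; simp
    · rw [← lie_skew, l31]; simp
    · exact l23
  have hpos : 0 < α ^ 2 + β ^ 2 := by
    by_contra h
    have ha := sq_nonneg α
    have hb := sq_nonneg β
    exact h0 ⟨by rw [← sq_eq_zero_iff]; linarith, by rw [← sq_eq_zero_iff]; linarith⟩
  set r := Real.sqrt (α ^ 2 + β ^ 2) with hr
  have hr0 : r ≠ 0 := (Real.sqrt_pos.2 hpos).ne'
  have hrr : r * r = α ^ 2 + β ^ 2 := Real.mul_self_sqrt hpos.le
  set x : 𝔤 := r⁻¹ • (α • e 2 + β • e 3) with hx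
  set y : 𝔤 := r⁻¹ • (α • e 3 - β • e 2) with hy
  have gxx : M.g x x = 1 := by
    simp [hx, he _ _]; field_simp; linarith
  have gyy : M.g y y = 1 := by
    simp [hy, he _ _]; field_simp; linarith
  have gxy : M.g x y = 0 := by
    simp [hx, hy, he _ _]; ring_nf; simp
  have gyx : M.g y x = 0 := (M.symm.eq x y).symm.trans gxy
  obtain ⟨f, hf, hfv⟩ := exists_orthonormal_extension hM hdim ![x, x, x, y] {2, 3}
    (by rintro i (rfl | rfl) j (rfl | rfl) <;> simp [gxx, gyy, gxy, gyx])
  have f2 : f 2 = x := hfv 2 (by simp)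
  have f3 : f 3 = y := hfv 3 (by simp)
  obtain ⟨m20, m21, m30, m31, m01, m23⟩ := hE.lie_of_codim_two hM hdim hf
    (by intro X Y; rw [f2, hx]; simp [h2, h3]) (by intro X Y; rw [f3, hy]; simp [h2, h3])
  have had : (LieAlgebra.ad ℝ 𝔤 y : 𝔤 →ₗ[ℝ] 𝔤) = 0 := by
    have l32 : ⁅e 3, e 2⁆ = 0 := by rw [← lie_skew, l23, neg_zero]
    have key : ∀ i, ⁅y, e i⁆ = 0 := by
      intro i
      rw [hy, smul_lie, sub_lie, smul_lie, smul_lie]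
      fin_cases i
      · change r⁻¹ • (α • ⁅e 3, e 0⁆ - β • ⁅e 2, e 0⁆) = 0
        rw [l30, l20, smul_smul, smul_smul, mul_comm, sub_self, smul_zero]
      · change r⁻¹ • (α • ⁅e 3, e 1⁆ - β • ⁅e 2, e 1⁆) = 0
        rw [l31, l21, smul_neg, smul_neg, smul_smul, smul_smul, mul_comm, sub_self, smul_zero]
      · change r⁻¹ • (α • ⁅e 3, e 2⁆ - β • ⁅e 2, e 2⁆) = 0
        rw [l32, lie_self]; simp
      · change r⁻¹ • (α • ⁅e 3, e 3⁆ - β • ⁅e 2, e 3⁆) = 0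
        rw [l23, lie_self]; simp
    exact e.ext fun i => key i
  have had' : ∀ X : 𝔤, ⁅X, f 3⁆ = 0 := by
    intro X
    rw [f3, ← lie_skew]
    have : ⁅y, X⁆ = 0 := LinearMap.congr_fun had X
    rw [this, neg_zero]
  generalize structConst f 2 0 1 = a at m20 m21
  rcases lt_trichotomy a 0 with ha | ha | ha
  · right
    refine ⟨f.reindex (Equiv.swap 0 1), -a, isOrthonormalBasis_reindex hf _, by linarith, ?_⟩
    have b0 : (f.reindex (Equiv.swap 0 1)) 0 = f 1 := by rw [Module.Basis.reindex_apply]; rfl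
    have b1 : (f.reindex (Equiv.swap 0 1)) 1 = f 0 := by rw [Module.Basis.reindex_apply]; rfl
    have b2 : (f.reindex (Equiv.swap 0 1)) 2 = f 2 := by rw [Module.Basis.reindex_apply]; rfl
    have b3 : (f.reindex (Equiv.swap 0 1)) 3 = f 3 := by rw [Module.Basis.reindex_apply]; rfl
    rw [b0, b1, b2, b3]
    refine ⟨by rw [m21, neg_smul], by rw [m20, neg_smul, neg_neg], ?_, had' _, had' _, had' _⟩
    rw [← lie_skew, m01, neg_zero]
  · left
    subst ha
    refine map_lie_eq_zero_of_basis f LinearMap.id ?_ ?_ ?_ ?_ ?_ ?_ <;>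
      rw [LinearMap.id_apply]
    · exact m01
    · rw [← lie_skew, m20]; simp
    · exact had' _
    · rw [← lie_skew, m21]; simp
    · exact had' _
    · exact had' _
  · right
    exact ⟨f, a, hf, ha, m20, m21, m01, had' _, had' _, had' _⟩

/-- The adjugate of `m` is the nonzero scalar `a² / 4`, so `m` is itself scalar with square `a² /
4`. The sign `ε` records which root occurs. -/
theorem IsGenEinstein.curved_normal_form (hE : M.IsGenEinstein δ) (hM : M.IsRiemannian)
    (hdim : Module.finrank ℝ 𝔤 = 4) (hH : M.H ≠ 0) (he : IsOrthonormalBasis M.g e)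
    (h3 : ∀ X Y : 𝔤, M.g ⁅X, Y⁆ (e 3) = 0) :
    ∃ a ε : ℝ, a ≠ 0 ∧ (ε = 1 ∨ ε = -1) ∧
      M.H = a • wedge3 (e.coord 0) (e.coord 1) (e.coord 2) ∧
      ⁅e 0, e 1⁆ = (ε * a) • e 2 ∧ ⁅e 1, e 2⁆ = (ε * a) • e 0 ∧ ⁅e 2, e 0⁆ = (ε * a) • e 1 := by
  have hform := form_eq_of_formConst fun j k => (hE.skew he h3 j k).2
  obtain ⟨m00, m11, m22, m01, m02, m12, ⟨c010, c011, c012⟩, ⟨c120, c121, c122⟩,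
    ⟨c020, c021, c022⟩, e0, e1, e2, e3, e4, e5⟩ := hE.normal_form hM hdim he h3
  have c3 := structConst_eq_zero_of_orthogonal he h3
  generalize M.formConst e 0 1 2 = a at hform e0 e1 e2
  have ha : a ≠ 0 := by
    rintro rfl
    rw [zero_smul] at hform
    exact hH hform
  have hs : a ^ 2 / 4 ≠ 0 := by positivity
  -- The off-diagonal entries of `m * adj m` vanish identically.
  have z01 : m01 = 0 := by
    apply (mul_eq_zero.1 (?_ : m01 * (a ^ 2 / 4) = 0)).resolve_right hs
    linear_combination -m01 * e1 - m00 * e5 - m02 * e3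
  have z02 : m02 = 0 := by
    apply (mul_eq_zero.1 (?_ : m02 * (a ^ 2 / 4) = 0)).resolve_right hs
    linear_combination -m02 * e2 - m00 * e4 - m01 * e3
  have z12 : m12 = 0 := by
    apply (mul_eq_zero.1 (?_ : m12 * (a ^ 2 / 4) = 0)).resolve_right hs
    linear_combination -m12 * e2 - m01 * e4 - m11 * e3
  subst z01 z02 z12
  have n0 : m00 ≠ 0 := by
    rintro rfl
    exact hs (by rw [← e1]; ring)
  have n2 : m22 ≠ 0 := by
    rintro rfl
    exact hs (by rw [← e1]; ring)
  have h01 : m11 = m00 := by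
    apply mul_right_cancel₀ n2; linarith
  have h12 : m22 = m11 := by
    apply mul_left_cancel₀ n0; linarith
  subst h01 h12
  have hε : ∃ ε : ℝ, (ε = 1 ∨ ε = -1) ∧ m22 + m22 = ε * a := by
    have : (2 * m22 - a) * (2 * m22 + a) = 0 := by linear_combination 4 * e0
    rcases mul_eq_zero.1 this with h | h
    · exact ⟨1, Or.inl rfl, by linarith⟩
    · exact ⟨-1, Or.inr rfl, by linarith⟩
  obtain ⟨ε, hε, hεa⟩ := hε
  rw [hεa] at c012 c120 c021
  refine ⟨a, ε, ha, hε, hform, ?_, ?_, ?_⟩ <;> rw [lie_basis e] <;>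
    simp [Fin.sum_univ_four, c3, c010, c011, c012, c120, c121, c122, c020, c021, c022,
      structConst_skew e 2 0]

theorem IsGenEinstein.curved_classification (hE : M.IsGenEinstein δ) (hM : M.IsRiemannian)
    (hdim : Module.finrank ℝ 𝔤 = 4) (hH : M.H ≠ 0) :
    ∃ (e : Module.Basis (Fin 4) ℝ 𝔤) (a b ε : ℝ),
      IsOrthonormalBasis M.g e ∧ a ≠ 0 ∧ (ε = 1 ∨ ε = -1) ∧
      M.H = a • wedge3 (e.coord 0) (e.coord 1) (e.coord 2) ∧
      ⁅e 0, e 1⁆ = (ε * a) • e 2 ∧ ⁅e 1, e 2⁆ = (ε * a) • e 0 ∧ ⁅e 2, e 0⁆ = (ε * a) • e 1 ∧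
      ⁅e 2, e 3⁆ = b • e 1 ∧ ⁅e 3, e 1⁆ = b • e 2 ∧ ⁅e 0, e 3⁆ = 0 := by
  obtain ⟨v, hv, hv'⟩ := exists_unit_orthogonal_commutator hM hdim
  obtain ⟨e, he, hev⟩ := exists_orthonormal_extension hM hdim (fun _ => v) {3}
    (by rintro i rfl j rfl; simpa using hv)
  have h3 : e 3 = v := hev 3 rfl
  -- The skew map `ad v` on the three-dimensional space `v^⊥` has a kernel. Taking `u` as first
  -- basis vector leaves a single rotation parameter `b`; the normal form holds in every basis
  -- ending in `v`.
  have hu : ∃ u, M.g u u = 1 ∧ M.g v u = 0 ∧ ⁅v, u⁆ = 0 := by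
    have h3' : ∀ X Y : 𝔤, M.g ⁅X, Y⁆ (e 3) = 0 := by rwa [h3]
    have sk := fun j k => (hE.skew he h3' j k).1
    have c3 := structConst_eq_zero_of_orthogonal he h3'
    have k0 : structConst e 3 0 0 = 0 := by linarith [sk 0 0]
    have k1 : structConst e 3 1 1 = 0 := by linarith [sk 1 1]
    have k2 : structConst e 3 2 2 = 0 := by linarith [sk 2 2]
    have l0 : ⁅e 3, e 0⁆ = structConst e 3 0 1 • e 1 + structConst e 3 0 2 • e 2 := by
      rw [lie_basis e]; simp [Fin.sum_univ_four, c3, k0]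
    have l1 : ⁅e 3, e 1⁆ = -(structConst e 3 0 1 • e 0) + structConst e 3 1 2 • e 2 := by
      rw [lie_basis e]; simp [Fin.sum_univ_four, c3, k1, sk 1 0]
    have l2 : ⁅e 3, e 2⁆ = -(structConst e 3 0 2 • e 0) + -(structConst e 3 1 2 • e 1) := by
      rw [lie_basis e]; simp [Fin.sum_univ_four, c3, k2, sk 2 0, sk 2 1]
    rw [← h3]
    generalize structConst e 3 0 1 = p at l0 l1
    generalize structConst e 3 0 2 = q at l0 l2
    generalize structConst e 3 1 2 = r at l1 l2
    by_cases h0 : p = 0 ∧ q = 0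
    · obtain ⟨rfl, rfl⟩ := h0
      exact ⟨e 0, by simp [he _ _], by simp [he _ _], by rw [l0]; simp⟩
    · have hpos : 0 < r ^ 2 + q ^ 2 + p ^ 2 := by
        by_contra h
        have ha := sq_nonneg p
        have hb := sq_nonneg q
        have hc := sq_nonneg r
        exact h0 ⟨by rw [← sq_eq_zero_iff]; linarith, by rw [← sq_eq_zero_iff]; linarith⟩
      set s := Real.sqrt (r ^ 2 + q ^ 2 + p ^ 2) with hs
      have hs0 : s ≠ 0 := (Real.sqrt_pos.2 hpos).ne'
      have hss : s * s = r ^ 2 + q ^ 2 + p ^ 2 := Real.mul_self_sqrt hpos.le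
      refine ⟨s⁻¹ • (r • e 0 + (-q) • e 1 + p • e 2), ?_, ?_, ?_⟩
      · simp [he _ _]; field_simp; linarith
      · simp [he _ _]
      · rw [lie_smul, lie_add, lie_add, lie_smul, lie_smul, lie_smul, l0, l1, l2]
        have : r • (p • e 1 + q • e 2) + (-q) • (-(p • e 0) + r • e 2)
          + p • (-(q • e 0) + -(r • e 1)) = 0 := by module
        rw [this, smul_zero]
  obtain ⟨u, hu, huv, had⟩ := hu
  have huv' : M.g u v = 0 := (M.symm.eq v u).symm.trans huv
  obtain ⟨f, hf, hfv⟩ := exists_orthonormal_extension hM hdim ![u, v, v, v] {0, 3}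
    (by rintro i (rfl | rfl) j (rfl | rfl) <;> simp [hu, hv, huv, huv'])
  have f0 : f 0 = u := hfv 0 (by simp)
  have f3 : f 3 = v := hfv 3 (by simp)
  have h3' : ∀ X Y : 𝔤, M.g ⁅X, Y⁆ (f 3) = 0 := by rwa [f3]
  obtain ⟨a, ε, ha, hε, hform, l01, l12, l20⟩ := hE.curved_normal_form hM hdim hH hf h3'
  have c30 : ⁅f 3, f 0⁆ = 0 := by rw [f0, f3, had]
  have sk := fun j k => (hE.skew hf h3' j k).1
  have c3 := structConst_eq_zero_of_orthogonal hf h3'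
  have k1 : structConst f 3 1 1 = 0 := by linarith [sk 1 1]
  have k2 : structConst f 3 2 2 = 0 := by linarith [sk 2 2]
  have k10 : structConst f 3 1 0 = 0 := by rw [sk, structConst, c30]; simp
  have k20 : structConst f 3 2 0 = 0 := by rw [sk, structConst, c30]; simp
  refine ⟨f, a, structConst f 3 1 2, ε, hf, ha, hε, hform, l01, l12, l20, ?_, ?_, ?_⟩
  · rw [← lie_skew, lie_basis f]
    simp [Fin.sum_univ_four, c3, k2, k20, sk 2 1]
  · rw [lie_basis f]
    simp [Fin.sum_univ_four, c3, k1, k10]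
  · rw [← lie_skew, c30, neg_zero]

end GenMetric

end

/-! ### Solving the Einstein equation for the divergence operator. -/

noncomputable section

section Divergence

variable {𝔤 : Type*} [LieRing 𝔤] [LieAlgebra ℝ 𝔤] (e : Module.Basis (Fin 4) ℝ 𝔤)
  (δ : Module.Dual ℝ (GenTangent 𝔤))

theorem dual_frameVec (s : ℝ) (i : Fin 4) :
    δ (frameVec e s i) = δ (e i, 0) + s * δ (0, e.coord i) := by
  rw [← smul_eq_mul, ← map_smul, ← map_add]
  simp [frameVec]

theorem dual_expansion : δ = ∑ i, δ (e i, 0) • covecFunctional (e.coord i)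
    + ∑ i, δ (0, e.coord i) • vecFunctional (e i) := by
  refine LinearMap.ext fun x => ?_
  have h : x = ∑ i, e.coord i x.1 • ((e i, 0) : GenTangent 𝔤)
      + ∑ i, x.2 (e i) • ((0, e.coord i) : GenTangent 𝔤) := by
    refine Prod.ext ?_ ?_
    · simp [Prod.fst_sum]
    · refine e.ext fun j => ?_
      simp [Prod.snd_sum]
  conv_lhs => rw [h]
  simp only [map_add, map_sum, map_smul, LinearMap.add_apply, LinearMap.sum_apply,
    LinearMap.smul_apply, smul_eq_mul]
  congr 1
  · refine Finset.sum_congr rfl fun i _ => ?_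
    rw [mul_comm]; rfl
  · refine Finset.sum_congr rfl fun i _ => ?_
    rw [mul_comm]; rfl

theorem mem_span_functionals_iff :
    δ ∈ Submodule.span ℝ {vecFunctional (e 2), vecFunctional (e 3),
      covecFunctional (e.coord 2), covecFunctional (e.coord 3)} ↔
    δ (e 0, 0) = 0 ∧ δ (e 1, 0) = 0 ∧ δ (0, e.coord 0) = 0 ∧ δ (0, e.coord 1) = 0 := by
  constructor
  · intro h
    simp only [Submodule.mem_span_insert, Submodule.mem_span_singleton] at h
    obtain ⟨p, _, ⟨q, _, ⟨r, _, ⟨t, rfl⟩, rfl⟩, rfl⟩, rfl⟩ := h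
    simp [vecFunctional, covecFunctional]
  · rintro ⟨h0, h1, h2, h3⟩
    rw [dual_expansion e δ]
    simp only [Fin.sum_univ_four, h0, h1, h2, h3, zero_smul, zero_add]
    refine Submodule.add_mem _ (Submodule.add_mem _ ?_ ?_) (Submodule.add_mem _ ?_ ?_) <;>
      exact Submodule.smul_mem _ _ (Submodule.subset_span (by simp))

end Divergence

namespace GenMetric

variable {𝔤 : Type*} [LieRing 𝔤] [LieAlgebra ℝ 𝔤] {e : Module.Basis (Fin 4) ℝ 𝔤}

theorem structConst_of_euclidean {a : ℝ} (h20 : ⁅e 2, e 0⁆ = a • e 1)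
    (h21 : ⁅e 2, e 1⁆ = -(a • e 0)) (h01 : ⁅e 0, e 1⁆ = 0) (h03 : ⁅e 0, e 3⁆ = 0)
    (h13 : ⁅e 1, e 3⁆ = 0) (h23 : ⁅e 2, e 3⁆ = 0) :
    structConst e = ![![0, 0, ![0, -a, 0, 0], 0], ![0, 0, ![a, 0, 0, 0], 0],
      ![![0, a, 0, 0], ![-a, 0, 0, 0], 0, 0], 0] := by
  have sw := structConst_skew e
  have r20 : ∀ k, structConst e 2 0 k = ![0, a, 0, 0] k := by
    intro k; fin_cases k <;> simp [structConst, h20]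
  have r21 : ∀ k, structConst e 2 1 k = ![-a, 0, 0, 0] k := by
    intro k; fin_cases k <;> simp [structConst, h21]
  have r01 : ∀ k, structConst e 0 1 k = 0 := by intro k; simp [structConst, h01]
  have r03 : ∀ k, structConst e 0 3 k = 0 := by intro k; simp [structConst, h03]
  have r13 : ∀ k, structConst e 1 3 k = 0 := by intro k; simp [structConst, h13]
  have r23 : ∀ k, structConst e 2 3 k = 0 := by intro k; simp [structConst, h23]
  funext i j k
  fin_cases i <;> fin_cases j <;>
    simp [structConst_self, r20, r21, r01, r03, r13, r23, sw 1 0, sw 0 2, sw 1 2, sw 3 0, sw 3 1,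
      sw 3 2] <;> fin_cases k <;> simp

theorem structConst_of_orthogonal {l b : ℝ} (h01 : ⁅e 0, e 1⁆ = l • e 2)
    (h12 : ⁅e 1, e 2⁆ = l • e 0) (h20 : ⁅e 2, e 0⁆ = l • e 1) (h23 : ⁅e 2, e 3⁆ = b • e 1)
    (h31 : ⁅e 3, e 1⁆ = b • e 2) (h03 : ⁅e 0, e 3⁆ = 0) :
    structConst e = ![![0, ![0, 0, l, 0], ![0, -l, 0, 0], 0],
      ![![0, 0, -l, 0], 0, ![l, 0, 0, 0], ![0, 0, -b, 0]],
      ![![0, l, 0, 0], ![-l, 0, 0, 0], 0, ![0, b, 0, 0]],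
      ![0, ![0, 0, b, 0], ![0, -b, 0, 0], 0]] := by
  have sw := structConst_skew e
  have r01 : ∀ k, structConst e 0 1 k = ![0, 0, l, 0] k := by
    intro k; fin_cases k <;> simp [structConst, h01]
  have r12 : ∀ k, structConst e 1 2 k = ![l, 0, 0, 0] k := by
    intro k; fin_cases k <;> simp [structConst, h12]
  have r20 : ∀ k, structConst e 2 0 k = ![0, l, 0, 0] k := by
    intro k; fin_cases k <;> simp [structConst, h20]
  have r23 : ∀ k, structConst e 2 3 k = ![0, b, 0, 0] k := by
    intro k; fin_cases k <;> simp [structConst, h23]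
  have r31 : ∀ k, structConst e 3 1 k = ![0, 0, b, 0] k := by
    intro k; fin_cases k <;> simp [structConst, h31]
  have r03 : ∀ k, structConst e 0 3 k = 0 := by intro k; simp [structConst, h03]
  funext i j k
  fin_cases i <;> fin_cases j <;>
    simp [structConst_self, r01, r12, r20, r23, r31, r03, sw 1 0, sw 2 1, sw 0 2, sw 3 2, sw 1 3,
      sw 3 0] <;> fin_cases k <;> simp

variable [FiniteDimensional ℝ 𝔤] {M : GenMetric 𝔤} {δ : Module.Dual ℝ (GenTangent 𝔤)}

omit [FiniteDimensional ℝ 𝔤] in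
theorem formConst_of_eq_zero (hH : M.H = 0) : M.formConst e = 0 := by
  funext i j k
  simp [formConst, hH]

omit [FiniteDimensional ℝ 𝔤] in
theorem formConst_of_eq_wedge3 {a : ℝ}
    (hH : M.H = a • wedge3 (e.coord 0) (e.coord 1) (e.coord 2)) :
    M.formConst e = ![![0, ![0, 0, a, 0], ![0, -a, 0, 0], 0], ![![0, 0, -a, 0], 0, ![a, 0, 0, 0], 0],
      ![![0, a, 0, 0], ![-a, 0, 0, 0], 0, 0], 0] := by
  funext i j k
  rw [formConst, hH, AlternatingMap.smul_apply, wedge3_apply, Matrix.det_fin_three]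
  fin_cases i <;> fin_cases j <;> fin_cases k <;> simp

theorem isGenEinstein_of_abelian (he : IsOrthonormalBasis M.g e) (hH : M.H = 0)
    (hc : structConst e = 0) : M.IsGenEinstein δ := by
  rw [isGenEinstein_iff he]
  intro s _ i j
  simp [dorfmanForm_frameVec, formConst_of_eq_zero hH, hc]

theorem isGenEinstein_iff_of_euclidean (he : IsOrthonormalBasis M.g e) (hH : M.H = 0) {a : ℝ}
    (ha : a ≠ 0) (h20 : ⁅e 2, e 0⁆ = a • e 1)
    (h21 : ⁅e 2, e 1⁆ = -(a • e 0)) (h01 : ⁅e 0, e 1⁆ = 0) (h03 : ⁅e 0, e 3⁆ = 0)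
    (h13 : ⁅e 1, e 3⁆ = 0) (h23 : ⁅e 2, e 3⁆ = 0) :
    M.IsGenEinstein δ ↔ δ ∈ Submodule.span ℝ {vecFunctional (e 2), vecFunctional (e 3),
      covecFunctional (e.coord 2), covecFunctional (e.coord 3)} := by
  rw [isGenEinstein_iff he, mem_span_functionals_iff]
  simp only [dorfmanForm_frameVec, formConst_of_eq_zero hH, dual_frameVec e δ,
    structConst_of_euclidean h20 h21 h01 h03 h13 h23, Fin.sum_univ_four]
  constructor
  · intro h
    -- Only the rotating direction `e 2` constrains `δ`; both signs are needed to separate its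
    -- vector and covector components.
    have p0 := h 1 (by norm_num) 2 0
    have p1 := h 1 (by norm_num) 2 1
    have q0 := h (-1) (by norm_num) 2 0
    have q1 := h (-1) (by norm_num) 2 1
    simp [ha] at p0 p1 q0 q1
    refine ⟨?_, ?_, ?_, ?_⟩ <;> linarith
  · rintro ⟨d0, d1, d2, d3⟩ s hs i j
    fin_cases i <;> fin_cases j <;> simp [d0, d1, d2, d3]

/-- The Einstein equation for `so(3) ⊕ ℝ`, before solving it for the divergence. -/
theorem isGenEinstein_iff_of_orthogonal_aux (he : IsOrthonormalBasis M.g e) {a b ε : ℝ}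
    (hε : ε * ε = 1) (hH : M.H = a • wedge3 (e.coord 0) (e.coord 1) (e.coord 2))
    (h01 : ⁅e 0, e 1⁆ = (ε * a) • e 2) (h12 : ⁅e 1, e 2⁆ = (ε * a) • e 0)
    (h20 : ⁅e 2, e 0⁆ = (ε * a) • e 1) (h23 : ⁅e 2, e 3⁆ = b • e 1)
    (h31 : ⁅e 3, e 1⁆ = b • e 2) (h03 : ⁅e 0, e 3⁆ = 0) :
    M.IsGenEinstein δ ↔ ∀ s : ℝ, s * s = 1 →
      (a * (1 + s * ε) * δ (frameVec e s 0) = 0 ∧ a * (1 + s * ε) * δ (frameVec e s 1) = 0 ∧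
        a * (1 + s * ε) * δ (frameVec e s 2) = 0) ∧
      b * δ (frameVec e s 1) = 0 ∧ b * δ (frameVec e s 2) = 0 := by
  rw [isGenEinstein_iff he]
  refine forall_congr' fun s => forall_congr' fun hs => ?_
  have hs0 : s ≠ 0 := by rintro rfl; simp at hs
  set t := a * (1 + s * ε) / 2 with ht
  set t' := a * (1 - s * ε) / 2 with ht'
  -- Only the product `t * t'` survives in the quadratic part, and one factor vanishes since `s * ε
  -- = ±1`. So `so(3) ⊕ ℝ` has vanishing divergence-free Ricci part for every `b`.
  have htt : t * t' = 0 := by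
    rw [ht, ht']; linear_combination (-a ^ 2 / 4 * (ε * ε)) * hs - a ^ 2 / 4 * hε
  have hta : a * (1 + s * ε) = 2 * t := by rw [ht]; ring
  have B1 : ∀ i j m, M.dorfmanForm (frameVec e (-s) i) (frameVec e s j) (frameVec e s m) =
      (![![0, ![0, 0, t, 0], ![0, -t, 0, 0], 0], ![![0, 0, -t, 0], 0, ![t, 0, 0, 0], 0],
        ![![0, t, 0, 0], ![-t, 0, 0, 0], 0, 0], ![0, ![0, 0, s * b, 0], ![0, -(s * b), 0, 0], 0]] :
        Fin 4 → Fin 4 → Fin 4 → ℝ) i j m := by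
    intro i j m
    rw [dorfmanForm_frameVec, formConst_of_eq_wedge3 hH,
      structConst_of_orthogonal h01 h12 h20 h23 h31 h03, ht]
    fin_cases i <;> fin_cases j <;> fin_cases m <;> simp <;> ring
  have B2 : ∀ i j m, M.dorfmanForm (frameVec e s i) (frameVec e (-s) j) (frameVec e (-s) m) =
      (![![0, ![0, 0, t', 0], ![0, -t', 0, 0], 0], ![![0, 0, -t', 0], 0, ![t', 0, 0, 0], 0],
        ![![0, t', 0, 0], ![-t', 0, 0, 0], 0, 0],
        ![0, ![0, 0, -(s * b), 0], ![0, s * b, 0, 0], 0]] : Fin 4 → Fin 4 → Fin 4 → ℝ) i j m := by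
    intro i j m
    rw [dorfmanForm_frameVec, formConst_of_eq_wedge3 hH,
      structConst_of_orthogonal h01 h12 h20 h23 h31 h03, ht']
    fin_cases i <;> fin_cases j <;> fin_cases m <;> simp <;> ring
  simp only [hta, B1, B2, Fin.sum_univ_four]
  generalize δ (frameVec e s 0) = d0
  generalize δ (frameVec e s 1) = d1
  generalize δ (frameVec e s 2) = d2
  generalize δ (frameVec e s 3) = d3
  clear_value t t'
  constructor
  · intro h
    have p0 := h 1 2
    have p1 := h 0 2
    have p2 := h 0 1
    have p3 := h 3 2
    have p4 := h 3 1
    simp [hs0] at p0 p1 p2 p3 p4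
    simp [p0, p1, p2, p3, p4]
  · rintro ⟨⟨h0, h1, h2⟩, h3, h4⟩ i j
    simp at h0 h1 h2 h3 h4
    fin_cases i <;> fin_cases j <;> simp [h0, h1, h2, h3, h4, htt, mul_comm t' t, mul_assoc]

/-- The factor `1 + s * ε` is zero for `s = -ε`, so the `so(3)` part constrains `δ` on only one
eigenspace. The rotation by `b` acts on both and kills both components in its plane. -/
theorem isGenEinstein_iff_of_orthogonal (he : IsOrthonormalBasis M.g e) {a b ε : ℝ}
    (ha : a ≠ 0) (hε : ε = 1 ∨ ε = -1)
    (hH : M.H = a • wedge3 (e.coord 0) (e.coord 1) (e.coord 2))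
    (h01 : ⁅e 0, e 1⁆ = (ε * a) • e 2) (h12 : ⁅e 1, e 2⁆ = (ε * a) • e 0)
    (h20 : ⁅e 2, e 0⁆ = (ε * a) • e 1) (h23 : ⁅e 2, e 3⁆ = b • e 1)
    (h31 : ⁅e 3, e 1⁆ = b • e 2) (h03 : ⁅e 0, e 3⁆ = 0) :
    M.IsGenEinstein δ ↔
    (b ≠ 0 →
      δ (e 0, 0) = -ε * δ (0, e.coord 0) ∧
      ∀ i ∈ ({1, 2} : Set (Fin 4)), δ (e i, 0) = 0 ∧ δ (0, e.coord i) = 0) ∧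
    (b = 0 →
      ∀ i ∈ ({0, 1, 2} : Set (Fin 4)), δ (e i, 0) = -ε * δ (0, e.coord i)) := by
  have hε2 : ε * ε = 1 := mul_self_eq_one_iff.2 hε
  rw [isGenEinstein_iff_of_orthogonal_aux he hε2 hH h01 h12 h20 h23 h31 h03]
  simp only [dual_frameVec e δ]
  constructor
  · intro h
    have key : ∀ i ∈ ({0, 1, 2} : Set (Fin 4)), δ (e i, 0) = -ε * δ (0, e.coord i) := by
      obtain ⟨⟨p0, p1, p2⟩, -⟩ := h ε hε2
      have h2 : a * (1 + ε * ε) ≠ 0 := by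
        rw [hε2]; exact mul_ne_zero ha (by norm_num)
      have p0' := (mul_eq_zero.1 p0).resolve_left h2
      have p1' := (mul_eq_zero.1 p1).resolve_left h2
      have p2' := (mul_eq_zero.1 p2).resolve_left h2
      rintro i (rfl | rfl | rfl) <;> linarith
    refine ⟨fun hb => ⟨key 0 (by simp), ?_⟩, fun _ => key⟩
    obtain ⟨-, p1, p2⟩ := h 1 (by norm_num)
    obtain ⟨-, q1, q2⟩ := h (-1) (by norm_num)
    have p1' := (mul_eq_zero.1 p1).resolve_left hb
    have p2' := (mul_eq_zero.1 p2).resolve_left hb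
    have q1' := (mul_eq_zero.1 q1).resolve_left hb
    have q2' := (mul_eq_zero.1 q2).resolve_left hb
    rintro i (rfl | rfl) <;> constructor <;> linarith
  · rintro ⟨hb, hb'⟩ s hs
    have h3 : (1 + s * ε) * (s - ε) = 0 := by linear_combination ε * hs - s * hε2
    have key : ∀ i, δ (e i, 0) = -ε * δ (0, e.coord i) →
        a * (1 + s * ε) * (δ (e i, 0) + s * δ (0, e.coord i)) = 0 := by
      intro i h
      rw [h]; linear_combination a * δ (0, e.coord i) * h3
    by_cases h0 : b = 0
    · exact ⟨⟨key 0 (hb' h0 0 (by simp)), key 1 (hb' h0 1 (by simp)), key 2 (hb' h0 2 (by simp))⟩,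
        by rw [h0, zero_mul], by rw [h0, zero_mul]⟩
    · obtain ⟨d0, hd⟩ := hb h0
      obtain ⟨d1, d1'⟩ := hd 1 (by simp)
      obtain ⟨d2, d2'⟩ := hd 2 (by simp)
      rw [d1, d1', d2, d2']
      exact ⟨⟨key 0 d0, by ring, by ring⟩, by ring, by ring⟩

end GenMetric

end

/-! ### Transport along isomorphisms, and the matrix models. -/

noncomputable section

section Transport

variable {𝔤 𝔥 : Type*} [LieRing 𝔤] [LieAlgebra ℝ 𝔤] [LieRing 𝔥] [LieAlgebra ℝ 𝔥]

theorem exists_lieEquiv_of_structConst {e : Module.Basis (Fin 4) ℝ 𝔤}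
    {b : Module.Basis (Fin 4) ℝ 𝔥} (h : structConst e = structConst b) :
    ∃ f : 𝔤 ≃ₗ⁅ℝ⁆ 𝔥, ∀ i, f (e i) = b i := by
  let L : 𝔤 ≃ₗ[ℝ] 𝔥 := e.equiv b (Equiv.refl _)
  have hL : ∀ i, L (e i) = b i := fun i => by simp [L]
  let B₁ : 𝔤 →ₗ[ℝ] 𝔤 →ₗ[ℝ] 𝔥 :=
    (LieAlgebra.ad ℝ 𝔤 : 𝔤 →ₗ[ℝ] 𝔤 →ₗ[ℝ] 𝔤).compr₂ (L : 𝔤 →ₗ[ℝ] 𝔥)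
  let B₂ : 𝔤 →ₗ[ℝ] 𝔤 →ₗ[ℝ] 𝔥 :=
    (LieAlgebra.ad ℝ 𝔥 : 𝔥 →ₗ[ℝ] 𝔥 →ₗ[ℝ] 𝔥).compl₁₂ (L : 𝔤 →ₗ[ℝ] 𝔥) (L : 𝔤 →ₗ[ℝ] 𝔥)
  have hB : B₁ = B₂ := by
    refine e.ext fun i => e.ext fun j => ?_
    change L ⁅e i, e j⁆ = ⁅L (e i), L (e j)⁆
    rw [hL, hL, lie_basis e, lie_basis b, map_sum, h]
    simp only [map_smul, hL]
  exact ⟨{ L with map_lie' := fun {X Y} => LinearMap.congr_fun₂ hB X Y }, hL⟩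

namespace GenMetric

/-- The transport of a generalised metric along an isomorphism of Lie algebras. -/
def map (M : GenMetric 𝔤) (f : 𝔤 ≃ₗ⁅ℝ⁆ 𝔥) : GenMetric 𝔥 where
  g := LinearMap.BilinForm.congr f.toLinearEquiv M.g
  symm := ⟨fun X Y => M.symm.eq _ _⟩
  nondegenerate := M.nondegenerate.congr f.toLinearEquiv
  H := M.H.compLinearMap (f.symm : 𝔥 →ₗ[ℝ] 𝔤)
  closed := by
    have hH : ∀ X Y Z : 𝔥, M.H.compLinearMap (f.symm : 𝔥 →ₗ[ℝ] 𝔤) ![X, Y, Z] =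
        M.H ![f.symm X, f.symm Y, f.symm Z] := by
      intro X Y Z
      rw [AlternatingMap.compLinearMap_apply]
      congr 1; ext i; fin_cases i <;> rfl
    intro X Y Z W
    simp only [hH, LieEquiv.map_lie]
    exact M.closed _ _ _ _

variable (M : GenMetric 𝔤) (f : 𝔤 ≃ₗ⁅ℝ⁆ 𝔥)

theorem map_g_apply (X Y : 𝔤) : (M.map f).g (f X) (f Y) = M.g X Y := by
  change M.g (f.symm (f X)) (f.symm (f Y)) = _
  rw [LieEquiv.symm_apply_apply, LieEquiv.symm_apply_apply]

theorem map_H_apply (X Y Z : 𝔤) : (M.map f).H ![f X, f Y, f Z] = M.H ![X, Y, Z] := by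
  change M.H.compLinearMap (f.symm : 𝔥 →ₗ[ℝ] 𝔤) _ = _
  rw [AlternatingMap.compLinearMap_apply]
  congr 1
  ext i
  fin_cases i <;> exact f.symm_apply_apply _

end GenMetric

/-- The transport of a divergence operator along an isomorphism of Lie algebras. -/
def mapDivergence (f : 𝔤 ≃ₗ⁅ℝ⁆ 𝔥) (δ : Module.Dual ℝ (GenTangent 𝔤)) :
    Module.Dual ℝ (GenTangent 𝔥) :=
  δ ∘ₗ LinearMap.prodMap (f.symm : 𝔥 →ₗ[ℝ] 𝔤) (LinearMap.lcomp ℝ ℝ (f : 𝔤 →ₗ[ℝ] 𝔥))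

theorem mapDivergence_apply (f : 𝔤 ≃ₗ⁅ℝ⁆ 𝔥) (δ : Module.Dual ℝ (GenTangent 𝔤)) (X : 𝔤)
    (ξ : Module.Dual ℝ 𝔤) :
    mapDivergence f δ (f X, ξ ∘ₗ (f.symm : 𝔥 →ₗ[ℝ] 𝔤)) = δ (X, ξ) := by
  change δ (f.symm (f X), (ξ ∘ₗ (f.symm : 𝔥 →ₗ[ℝ] 𝔤)) ∘ₗ (f : 𝔤 →ₗ[ℝ] 𝔥)) = _
  congr 2
  · exact f.symm_apply_apply X
  · ext Y
    exact congrArg ξ (f.symm_apply_apply Y)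

theorem genIsomorphic_map (M : GenMetric 𝔤) (δ : Module.Dual ℝ (GenTangent 𝔤))
    (f : 𝔤 ≃ₗ⁅ℝ⁆ 𝔥) : GenIsomorphic M δ (M.map f) (mapDivergence f δ) :=
  ⟨f, M.map_g_apply f, M.map_H_apply f, mapDivergence_apply f δ⟩

variable (M : GenMetric 𝔤) (δ : Module.Dual ℝ (GenTangent 𝔤)) {e : Module.Basis (Fin 4) ℝ 𝔤}
  {b : Module.Basis (Fin 4) ℝ 𝔥} {f : 𝔤 ≃ₗ⁅ℝ⁆ 𝔥}

theorem coord_eq_comp_symm (hf : ∀ i, f (e i) = b i) (i : Fin 4) :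
    b.coord i = e.coord i ∘ₗ (f.symm : 𝔥 →ₗ[ℝ] 𝔤) := by
  refine b.ext fun j => ?_
  have : f.symm (b j) = e j := by rw [← hf, LieEquiv.symm_apply_apply]
  change _ = e.coord i (f.symm (b j))
  rw [this]
  simp [Finsupp.single_apply]

theorem mapDivergence_basis (hf : ∀ i, f (e i) = b i) (i : Fin 4) :
    mapDivergence f δ (b i, 0) = δ (e i, 0) := by
  rw [← mapDivergence_apply f δ (e i) 0, hf, LinearMap.zero_comp]

theorem mapDivergence_coord (hf : ∀ i, f (e i) = b i) (i : Fin 4) :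
    mapDivergence f δ (0, b.coord i) = δ (0, e.coord i) := by
  rw [← mapDivergence_apply f δ 0 (e.coord i), map_zero, coord_eq_comp_symm hf]

theorem isOrthonormalBasis_map (hf : ∀ i, f (e i) = b i) (he : IsOrthonormalBasis M.g e) :
    IsOrthonormalBasis (M.map f).g b := by
  intro i j
  rw [← hf, ← hf, GenMetric.map_g_apply, he]

theorem map_H_eq_zero (hH : M.H = 0) : (M.map f).H = 0 := by
  change M.H.compLinearMap _ = 0
  rw [hH]; rfl

theorem map_H_eq_wedge3 (hf : ∀ i, f (e i) = b i) {a : ℝ}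
    (hH : M.H = a • wedge3 (e.coord 0) (e.coord 1) (e.coord 2)) :
    (M.map f).H = a • wedge3 (b.coord 0) (b.coord 1) (b.coord 2) := by
  have h : M.formConst e 0 1 2 = (M.map f).formConst b 0 1 2 := by
    simp only [GenMetric.formConst, ← hf, GenMetric.map_H_apply]
  have h3 : ∀ j k, (M.map f).formConst b 3 j k = 0 := by
    intro j k
    have : (M.map f).formConst b 3 j k = M.formConst e 3 j k := by
      simp only [GenMetric.formConst, ← hf, GenMetric.map_H_apply]
    rw [this, GenMetric.formConst_of_eq_wedge3 hH]
    simp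
  rw [GenMetric.form_eq_of_formConst h3, ← h, GenMetric.formConst_of_eq_wedge3 hH]
  simp

/-- Families (ii) and (iii) assume positivity only through their orthonormal basis. -/
theorem isRiemannian_of_orthonormal {M : GenMetric 𝔤} (he : IsOrthonormalBasis M.g e) :
    M.IsRiemannian := by
  intro X hX
  have h : M.g X X = ∑ i, e.coord i X ^ 2 := by
    conv_lhs => rw [← e.sum_repr X]
    simp only [map_sum, map_smul, LinearMap.sum_apply, LinearMap.smul_apply, he _ _, smul_eq_mul,
      mul_ite, mul_one, mul_zero, Finset.sum_ite_eq', Finset.mem_univ, if_true,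
      sq]
    rfl
  rw [h]
  refine lt_of_le_of_ne (Finset.sum_nonneg fun i _ => sq_nonneg _) fun h0 => hX ?_
  refine e.ext_elem fun i => ?_
  have := (Finset.sum_eq_zero_iff_of_nonneg (fun i _ => sq_nonneg _)).1 h0.symm i
    (Finset.mem_univ _)
  rw [map_zero]
  exact pow_eq_zero_iff two_ne_zero |>.1 this

end Transport

section Models

theorem lie_pi_eq_zero (X Y : Fin 4 → ℝ) : ⁅X, Y⁆ = 0 := by
  funext i
  change ⁅X i, Y i⁆ = 0
  rw [Ring.lie_def, mul_comm, sub_self]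

/-- The bracket of a matrix Lie algebra plus a one-dimensional centre. -/
theorem lie_prod_matrix (S : LieSubalgebra ℝ (Matrix (Fin 3) (Fin 3) ℝ)) (x y : S × ℝ) :
    (⁅x, y⁆.1 : Matrix (Fin 3) (Fin 3) ℝ) = x.1.1 * y.1.1 - y.1.1 * x.1.1 ∧ ⁅x, y⁆.2 = 0 := by
  refine ⟨rfl, ?_⟩
  change ⁅x.2, y.2⁆ = 0
  rw [Ring.lie_def, mul_comm, sub_self]

theorem exists_coordinates_euclidean {a : ℝ} (ha : a ≠ 0) :
    ∃ L : (euclideanLieAlgebra2 × ℝ) ≃ₗ[ℝ] (Fin 4 → ℝ),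
      (∀ x, L x = ![x.1.1 0 2, x.1.1 1 2, x.1.1 1 0 / a, x.2]) ∧
      ∀ v, ((L.symm v).1 : Matrix (Fin 3) (Fin 3) ℝ) =
        !![0, -(a * v 2), v 0; a * v 2, 0, v 1; 0, 0, 0] := by
  refine ⟨
    { toFun := fun x => ![x.1.1 0 2, x.1.1 1 2, x.1.1 1 0 / a, x.2]
      map_add' := by
        intro x y; ext i; fin_cases i <;> simp [add_div]
      map_smul' := by
        intro c x; ext i; fin_cases i <;> simp [mul_div_assoc]
      invFun := fun v => (⟨!![0, -(a * v 2), v 0; a * v 2, 0, v 1; 0, 0, 0], by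
        refine ⟨by simp, by simp, by simp, fun j => ?_⟩
        fin_cases j <;> simp⟩, v 3)
      left_inv := by
        rintro ⟨⟨A, h1, h2, h3, h4⟩, t⟩
        refine Prod.ext (Subtype.ext ?_) rfl
        ext i j
        have h40 := h4 0
        have h41 := h4 1
        have h42 := h4 2
        fin_cases i <;> fin_cases j <;> simp [h1, h2, h3, h40, h41, h42, mul_div_cancel₀, ha]
      right_inv := by
        intro v; ext i; fin_cases i <;> simp [ha] }, fun _ => rfl, fun _ => rfl⟩

theorem exists_basis_euclidean {a : ℝ} (ha : a ≠ 0) :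
    ∃ b : Module.Basis (Fin 4) ℝ (euclideanLieAlgebra2 × ℝ),
      ⁅b 2, b 0⁆ = a • b 1 ∧ ⁅b 2, b 1⁆ = -(a • b 0) ∧ ⁅b 0, b 1⁆ = 0 ∧ ⁅b 0, b 3⁆ = 0 ∧
      ⁅b 1, b 3⁆ = 0 ∧ ⁅b 2, b 3⁆ = 0 := by
  obtain ⟨L, hL, hS⟩ := exists_coordinates_euclidean ha
  have hlie : ∀ v w, ⁅L.symm v, L.symm w⁆ =
      L.symm ![a * (v 1 * w 2 - v 2 * w 1), a * (v 2 * w 0 - v 0 * w 2), 0, 0] := by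
    intro v w
    obtain ⟨h1, h2⟩ := lie_prod_matrix _ (L.symm v) (L.symm w)
    rw [LinearEquiv.eq_symm_apply, hL, h1, h2, hS, hS]
    ext i
    fin_cases i <;> simp <;> ring
  refine ⟨Module.Basis.ofEquivFun L, ?_⟩
  simp only [Module.Basis.coe_ofEquivFun, hlie, ← map_smul, ← map_neg]
  refine ⟨?_, ?_, ?_, ?_, ?_, ?_⟩ <;>
  · first | rw [LinearEquiv.map_eq_zero_iff] | refine congrArg L.symm ?_
    ext i
    fin_cases i <;> simp

theorem exists_coordinates_orthogonal {l : ℝ} (hl : l ≠ 0) (c : ℝ) :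
    ∃ L : (LieAlgebra.Orthogonal.so (Fin 3) ℝ × ℝ) ≃ₗ[ℝ] (Fin 4 → ℝ),
      (∀ x, L x = ![(x.1.1 2 1 - c * x.2) / l, x.1.1 0 2 / l, x.1.1 1 0 / l, x.2]) ∧
      ∀ v, ((L.symm v).1 : Matrix (Fin 3) (Fin 3) ℝ) =
        !![0, -(l * v 2), l * v 1; l * v 2, 0, -(l * v 0 + c * v 3);
          -(l * v 1), l * v 0 + c * v 3, 0] := by
  refine ⟨
    { toFun := fun x => ![(x.1.1 2 1 - c * x.2) / l, x.1.1 0 2 / l, x.1.1 1 0 / l, x.2]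
      map_add' := by
        intro x y; ext i; fin_cases i <;> simp <;> ring
      map_smul' := by
        intro c x; ext i; fin_cases i <;> simp <;> ring
      invFun := fun v => (⟨!![0, -(l * v 2), l * v 1; l * v 2, 0, -(l * v 0 + c * v 3);
          -(l * v 1), l * v 0 + c * v 3, 0], by
        rw [LieAlgebra.Orthogonal.mem_so]
        ext i j
        fin_cases i <;> fin_cases j <;> simp⟩, v 3)
      left_inv := by
        rintro ⟨⟨A, hA⟩, t⟩
        rw [LieAlgebra.Orthogonal.mem_so] at hA
        have h : ∀ i j, A j i = -A i j := fun i j => congrFun (congrFun hA i) j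
        refine Prod.ext (Subtype.ext ?_) rfl
        have d0 := h 0 0
        have d1 := h 1 1
        have d2 := h 2 2
        have h01 := h 0 1
        have h02 := h 0 2
        have h12 := h 1 2
        ext i j
        fin_cases i <;> fin_cases j <;> simp [mul_div_cancel₀, hl] <;> linarith
      right_inv := by
        intro v; ext i; fin_cases i <;> simp [hl] }, fun _ => rfl, fun _ => rfl⟩

/-- The last basis vector is a central element plus `(c / l) • b 0`. So every value of the parameter
`c` gives the same Lie algebra and only the position of the basis changes. -/
theorem exists_basis_orthogonal {l : ℝ} (hl : l ≠ 0) (c : ℝ) :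
    ∃ b : Module.Basis (Fin 4) ℝ (LieAlgebra.Orthogonal.so (Fin 3) ℝ × ℝ),
      ⁅b 0, b 1⁆ = l • b 2 ∧ ⁅b 1, b 2⁆ = l • b 0 ∧ ⁅b 2, b 0⁆ = l • b 1 ∧
      ⁅b 2, b 3⁆ = c • b 1 ∧ ⁅b 3, b 1⁆ = c • b 2 ∧ ⁅b 0, b 3⁆ = 0 := by
  obtain ⟨L, hL, hS⟩ := exists_coordinates_orthogonal hl c
  have hlie : ∀ v w, ⁅L.symm v, L.symm w⁆ =
      L.symm ![l * (v 1 * w 2 - v 2 * w 1),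
        v 2 * (l * w 0 + c * w 3) - (l * v 0 + c * v 3) * w 2,
        (l * v 0 + c * v 3) * w 1 - v 1 * (l * w 0 + c * w 3), 0] := by
    intro v w
    obtain ⟨h1, h2⟩ := lie_prod_matrix _ (L.symm v) (L.symm w)
    rw [LinearEquiv.eq_symm_apply, hL, h1, h2, hS, hS]
    ext i
    fin_cases i <;> simp <;> field_simp <;> ring
  refine ⟨Module.Basis.ofEquivFun L, ?_⟩
  simp only [Module.Basis.coe_ofEquivFun, hlie, ← map_smul]
  refine ⟨?_, ?_, ?_, ?_, ?_, ?_⟩ <;>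
  · first | rw [LinearEquiv.map_eq_zero_iff] | refine congrArg L.symm ?_
    ext i
    fin_cases i <;> simp

end Models

end

/-! ### The classification theorem. -/

theorem mainTheorem5 :
    (∀ (𝔤 : Type*) [LieRing 𝔤] [LieAlgebra ℝ 𝔤] [FiniteDimensional ℝ 𝔤]
        (M : GenMetric 𝔤) (δ : Module.Dual ℝ (GenTangent 𝔤)),
      Module.finrank ℝ 𝔤 = 4 → M.IsRiemannian → M.IsGenEinstein δ →
        (∃ M' δ', FamilyAbelian M' δ' ∧ GenIsomorphic M δ M' δ') ∨
        (∃ M' δ', FamilyEuclidean M' δ' ∧ GenIsomorphic M δ M' δ') ∨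
        (∃ M' δ', FamilyOrthogonal M' δ' ∧ GenIsomorphic M δ M' δ')) ∧
    (∀ M δ, FamilyAbelian M δ → M.IsRiemannian ∧ M.IsGenEinstein δ) ∧
    (∀ M δ, FamilyEuclidean M δ → M.IsRiemannian ∧ M.IsGenEinstein δ) ∧
    (∀ M δ, FamilyOrthogonal M δ → M.IsRiemannian ∧ M.IsGenEinstein δ) := by
  refine ⟨?_, ?_, ?_, ?_⟩
  · intro 𝔤 _ _ _ M δ hdim hM hE
    by_cases hH : M.H = 0
    · rcases hE.flat_classification hM hdim hH with hab | ⟨e, a, he, ha, h20, h21, h01, h03, h13, h23⟩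
      · left
        -- Extending the empty family yields an arbitrary orthonormal basis.
        obtain ⟨e, he, -⟩ := GenMetric.exists_orthonormal_extension hM hdim (fun _ => 0) ∅ (by simp)
        have hc : structConst e = structConst (Pi.basisFun ℝ (Fin 4)) := by
          funext i j k
          rw [structConst, structConst, hab, lie_pi_eq_zero, map_zero, map_zero]
        obtain ⟨f, hf⟩ := exists_lieEquiv_of_structConst hc
        exact ⟨M.map f, mapDivergence f δ,
          ⟨isRiemannian_of_orthonormal (isOrthonormalBasis_map M hf he), map_H_eq_zero M hH⟩,
          genIsomorphic_map M δ f⟩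
      · right; left
        obtain ⟨b, b20, b21, b01, b03, b13, b23⟩ := exists_basis_euclidean ha.ne'
        obtain ⟨f, hf⟩ := exists_lieEquiv_of_structConst
          ((GenMetric.structConst_of_euclidean h20 h21 h01 h03 h13 h23).trans
            (GenMetric.structConst_of_euclidean b20 b21 b01 b03 b13 b23).symm)
        have hδ := (GenMetric.isGenEinstein_iff_of_euclidean he hH ha.ne' h20 h21 h01 h03 h13
          h23).1 hE
        rw [mem_span_functionals_iff] at hδ
        refine ⟨M.map f, mapDivergence f δ, ⟨map_H_eq_zero M hH, b, a,
          isOrthonormalBasis_map M hf he, ha, b20, b21, b01, b03, b13, b23, ?_⟩,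
          genIsomorphic_map M δ f⟩
        rw [mem_span_functionals_iff]
        simpa only [mapDivergence_basis δ hf, mapDivergence_coord δ hf] using hδ
    · right; right
      obtain ⟨e, a, c, ε, he, ha, hε, hform, h01, h12, h20, h23, h31, h03⟩ :=
        hE.curved_classification hM hdim hH
      have hl : ε * a ≠ 0 := by
        rcases hε with rfl | rfl <;> simpa using ha
      obtain ⟨b, b01, b12, b20, b23, b31, b03⟩ := exists_basis_orthogonal hl c
      obtain ⟨f, hf⟩ := exists_lieEquiv_of_structConst
        ((GenMetric.structConst_of_orthogonal h01 h12 h20 h23 h31 h03).trans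
          (GenMetric.structConst_of_orthogonal b01 b12 b20 b23 b31 b03).symm)
      have hδ := (GenMetric.isGenEinstein_iff_of_orthogonal he ha hε hform h01 h12 h20 h23 h31
        h03).1 hE
      refine ⟨M.map f, mapDivergence f δ, ⟨b, a, c, ε, isOrthonormalBasis_map M hf he, ha, hε,
        map_H_eq_wedge3 M hf hform, b01, b12, b20, b23, b31, b03, ?_⟩, genIsomorphic_map M δ f⟩
      simpa only [mapDivergence_basis δ hf, mapDivergence_coord δ hf] using hδ
  · rintro M δ ⟨hM, hH⟩
    obtain ⟨e, he, -⟩ := GenMetric.exists_orthonormal_extension hM (by simp) (fun _ => 0) ∅ (by simp)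
    refine ⟨hM, GenMetric.isGenEinstein_of_abelian he hH ?_⟩
    funext i j k
    rw [structConst, lie_pi_eq_zero, map_zero]; rfl
  · rintro M δ ⟨hH, e, a, he, ha, h20, h21, h01, h03, h13, h23, hδ⟩
    exact ⟨isRiemannian_of_orthonormal he, (GenMetric.isGenEinstein_iff_of_euclidean he hH ha.ne'
      h20 h21 h01 h03 h13 h23).2 hδ⟩
  · rintro M δ ⟨e, a, b, ε, he, ha, hε, hform, h01, h12, h20, h23, h31, h03, hδ⟩
    exact ⟨isRiemannian_of_orthonormal he, (GenMetric.isGenEinstein_iff_of_orthogonal he ha hε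
      hform h01 h12 h20 h23 h31 h03).2 hδ⟩
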